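/- Let $n,m\ge 0$ be integers, $A,Q\in\mathbb R^{n\times n}$, $B,S\in\mathbb R^{n\times m}$, $R\in\mathbb R^{m\times m}$, and suppose that $\Pi=\begin{bmatrix}Q&S\\S^{\mathsf T}&R\end{bmatrix}$ is symmetric positive semidefinite. Let $R^\dagger$ be the Moore–Penrose pseudo-inverse of $R$, let $G=I_m-R^\dagger R$ (the orthogonal projector onto $\ker R$), $F=A-BR^\dagger S^{\mathsf T}$, and let $\mathcal R$ be the reachable subspace of the pair $(F,BG)$, that is, the image of $U=[\,BG\;\;FBG\;\cdots\;F^{n-1}BG\,]$. Assume that there is a symmetric matrix $X$ with $$XA+A^{\mathsf T}X-(S+XB)R^\dagger(S^{\mathsf T}+B^{\mathsf T}X)+Q=0,\qquad \ker R\subseteq\ker(S+XB).$$ Let $T>0$ and let $H\in\mathbb R^{n\times n}$ be symmetric positive semidefinite. For $x_0\in\mathbb R^n$ consider the problem of minimising $$J_{T,H}(x_0,u)=\int_0^T\begin{bmatrix}x(t)\\u(t)\end{bmatrix}^{\mathsf T}\Pi\begin{bmatrix}x(t)\\u(t)\end{bmatrix}dt+x(T)^{\mathsf T}Hx(T)$$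 over all impulse-free controls $u\in L^2([0,T];\mathbb R^m)$, where $x$ is the solution of $\dot x=Ax+Bu$, $x(0)=x_0$. For a symmetric positive semidefinite matrix $K$, consider the terminal value problem $$\dot P_T+P_TA+A^{\mathsf T}P_T-(S+P_TB)R^\dagger(S^{\mathsf T}+B^{\mathsf T}P_T)+Q=0\quad\text{on }(-\infty,T],\qquad P_T(T)=K,\tag{$*_K$}$$ and, for a solution $P_T$ of it and $v\in L^2([0,T];\mathbb R^m)$, the relation $$u(t)=-R^\dagger\bigl(S^{\mathsf T}+B^{\mathsf T}P_T(t)\bigr)x(t)+G\,v(t)\quad\text{for almost every }t\in[0,T].\tag{$**$}$$ 1. For every $x_0$ an impulse-free optimal control exists. 2. Suppose that $H\mathcal R=\{0\}$. Then $(*_H)$ has a unique solution $P_T$. For every $x_0$, an impulse-free control $u$ with trajectory $x$ is optimal if and only if $(**)$ holds for some $v\in L^2([0,T];\mathbb R^m)$; every such $v$ occurs for some control $u$ with its trajectory $x$ from $x_0$; and the optimal cost is $x_0^{\mathsf T}P_T(0)x_0$. 3. For arbitrary $H$, put $H'=H-HU(U^{\mathsf T}HU)^\dagger U^{\mathsf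 T}H$ (so $H'=H$ if $H\mathcal R=\{0\}$). Then $(*_{H'})$ has a unique solution $P_T$. For every $x_0$, an impulse-free control $u$ with trajectory $x$ is optimal for $J_{T,H}$ if and only if $(**)$ holds for some $v\in L^2([0,T];\mathbb R^m)$ and $Hx(T)$ is orthogonal to $\mathcal R$; and the optimal cost is $x_0^{\mathsf T}P_T(0)x_0$. -/

import Mathlib

open Matrix MeasureTheory

section MoorePenrose

variable {ι κ : Type*} [Fintype ι] [Fintype κ]

/-- The four Penrose conditions: `N` is the Moore-Penrose pseudo-inverse of the real matrix `M`. -/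
structure IsMoorePenroseInverse (M : Matrix ι κ ℝ) (N : Matrix κ ι ℝ) : Prop where
  mul_mul_left : M * N * M = M
  mul_mul_right : N * M * N = N
  isSymm_left : (M * N).IsSymm
  isSymm_right : (N * M).IsSymm

theorem IsMoorePenroseInverse.unique {M : Matrix ι κ ℝ} {N N' : Matrix κ ι ℝ}
    (h : IsMoorePenroseInverse M N) (h' : IsMoorePenroseInverse M N') : N = N' := by
  have e1 : M * N = M * N' := by
    have h1 : (M * N' * (M * N))ᵀ = M * N := by
      rw [← Matrix.mul_assoc, h'.mul_mul_left]; exact h.isSymm_left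
    rw [Matrix.transpose_mul, h.isSymm_left.eq, h'.isSymm_left.eq, ← Matrix.mul_assoc,
      h.mul_mul_left] at h1
    exact h1.symm
  have e2 : N * M = N' * M := by
    have h1 : (N * M * (N' * M))ᵀ = N * M := by
      rw [Matrix.mul_assoc, ← Matrix.mul_assoc M, h'.mul_mul_left]; exact h.isSymm_right
    rw [Matrix.transpose_mul, h.isSymm_right.eq, h'.isSymm_right.eq, Matrix.mul_assoc,
      ← Matrix.mul_assoc M, h.mul_mul_left] at h1
    exact h1.symm
  calc N = N * M * N := h.mul_mul_right.symm
    _ = N' * M * N' := by rw [e2, Matrix.mul_assoc, e1, ← Matrix.mul_assoc]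
    _ = N' := h'.mul_mul_right

theorem exists_isMoorePenroseInverse [DecidableEq κ] (M : Matrix ι κ ℝ) :
    ∃ N : Matrix κ ι ℝ, IsMoorePenroseInverse M N := by
  have hD : (Mᵀ * M).IsHermitian := by
    simpa [Matrix.conjTranspose_eq_transpose_of_trivial] using
      Matrix.isHermitian_conjTranspose_mul_self M
  obtain ⟨C, hCs, hcomm, hDCD, hCDC⟩ : ∃ C : Matrix κ κ ℝ, Cᵀ = C ∧
      C * (Mᵀ * M) = Mᵀ * M * C ∧ Mᵀ * M * C * (Mᵀ * M) = Mᵀ * M ∧ C * (Mᵀ * M) * C = C := by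
    generalize Mᵀ * M = D at hD
    set V : Matrix κ κ ℝ := (hD.eigenvectorUnitary : Matrix κ κ ℝ) with hV
    set d := hD.eigenvalues with hd
    have hVV : Vᵀ * V = 1 := by
      have := Unitary.coe_star_mul_self hD.eigenvectorUnitary
      simpa [Matrix.star_eq_conjTranspose, Matrix.conjTranspose_eq_transpose_of_trivial] using this
    have hDs : D = V * diagonal d * Vᵀ := by
      have := hD.spectral_theorem
      rw [Unitary.conjStarAlgAut_apply] at this
      simpa [Matrix.star_eq_conjTranspose, Matrix.conjTranspose_eq_transpose_of_trivial,
        Function.comp_def] using this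
    have key : ∀ a b : κ → ℝ, V * diagonal a * Vᵀ * (V * diagonal b * Vᵀ)
        = V * diagonal (fun i => a i * b i) * Vᵀ := by
      intro a b
      calc V * diagonal a * Vᵀ * (V * diagonal b * Vᵀ)
          = V * diagonal a * (Vᵀ * V) * diagonal b * Vᵀ := by simp only [Matrix.mul_assoc]
        _ = _ := by
          rw [hVV, Matrix.mul_one, Matrix.mul_assoc V, Matrix.diagonal_mul_diagonal]
    refine ⟨V * diagonal (fun i => (d i)⁻¹) * Vᵀ, ?_, ?_, ?_, ?_⟩
    · simp [Matrix.transpose_mul, Matrix.mul_assoc]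
    · rw [hDs, key, key]; simp only [mul_comm]
    · rw [hDs, key, key]; simp only [mul_inv_mul_cancel]
    · rw [hDs, key, key]
      have : (fun i => (d i)⁻¹ * d i * (d i)⁻¹) = fun i => (d i)⁻¹ := by
        funext i; simpa using mul_inv_mul_cancel (d i)⁻¹
      rw [this]
  have hMC : M * C * (Mᵀ * M) = M := by
    have h0 : (M * C * (Mᵀ * M) - M)ᴴ * (M * C * (Mᵀ * M) - M) = 0 := by
      have hT : (M * C * (Mᵀ * M) - M)ᴴ = Mᵀ * M * C * Mᵀ - Mᵀ := by
        rw [Matrix.conjTranspose_eq_transpose_of_trivial]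
        simp only [Matrix.transpose_sub, Matrix.transpose_mul, Matrix.transpose_transpose, hCs,
          Matrix.mul_assoc]
      have e : (Mᵀ * M * C * Mᵀ - Mᵀ) * (M * C * (Mᵀ * M) - M)
          = Mᵀ * M * C * (Mᵀ * M * C * (Mᵀ * M)) - Mᵀ * M * C * (Mᵀ * M)
            - (Mᵀ * M * C * (Mᵀ * M) - Mᵀ * M) := by
        simp only [Matrix.sub_mul, Matrix.mul_sub, Matrix.mul_assoc]
      rw [hT, e, hDCD, hDCD]; simp
    exact sub_eq_zero.mp (Matrix.conjTranspose_mul_self_eq_zero.mp h0)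
  refine ⟨C * Mᵀ, ?_, ?_, ?_, ?_⟩
  · simpa only [Matrix.mul_assoc] using hMC
  · calc C * Mᵀ * M * (C * Mᵀ) = C * (Mᵀ * M) * C * Mᵀ := by simp only [Matrix.mul_assoc]
      _ = C * Mᵀ := by rw [hCDC]
  · simp only [Matrix.IsSymm, Matrix.transpose_mul, Matrix.transpose_transpose, hCs,
      Matrix.mul_assoc]
  · have : C * Mᵀ * M = C * (Mᵀ * M) := Matrix.mul_assoc _ _ _
    simp only [Matrix.IsSymm, this]
    rw [Matrix.transpose_mul, hCs, Matrix.transpose_mul, Matrix.transpose_transpose, ← hcomm]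

/-- The Moore-Penrose pseudo-inverse `M†` of a real matrix. -/
noncomputable def pinv [DecidableEq κ] (M : Matrix ι κ ℝ) : Matrix κ ι ℝ :=
  (exists_isMoorePenroseInverse M).choose

theorem pinv_spec [DecidableEq κ] (M : Matrix ι κ ℝ) : IsMoorePenroseInverse M (pinv M) :=
  (exists_isMoorePenroseInverse M).choose_spec

end MoorePenrose

/-- The data `Σ = (A, B, Q, S, R)` of a linear-quadratic problem with `n` states and `m` inputs. -/
structure LQSystem (n m : ℕ) where
  A : Matrix (Fin n) (Fin n) ℝ
  B : Matrix (Fin n) (Fin m) ℝ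
  Q : Matrix (Fin n) (Fin n) ℝ
  S : Matrix (Fin n) (Fin m) ℝ
  R : Matrix (Fin m) (Fin m) ℝ

namespace LQSystem

variable {n m : ℕ} (Sys : LQSystem n m)

/-- The Popov matrix `Π = [Q S; Sᵀ R]`. -/
def popov : Matrix (Fin n ⊕ Fin m) (Fin n ⊕ Fin m) ℝ :=
  fromBlocks Sys.Q Sys.S Sys.Sᵀ Sys.R

/-- The orthogonal projector `G = I - R† R` onto `ker R`. -/
noncomputable def G : Matrix (Fin m) (Fin m) ℝ := 1 - pinv Sys.R * Sys.R

/-- The feedback gain `K_X = R† (Sᵀ + Bᵀ X)`. -/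
noncomputable def gain (X : Matrix (Fin n) (Fin n) ℝ) : Matrix (Fin m) (Fin n) ℝ :=
  pinv Sys.R * (Sys.Sᵀ + Sys.Bᵀ * X)

/-- The Riccati operator `X A + Aᵀ X - (S + X B) R† (Sᵀ + Bᵀ X) + Q`. -/
noncomputable def riccati (X : Matrix (Fin n) (Fin n) ℝ) : Matrix (Fin n) (Fin n) ℝ :=
  X * Sys.A + Sys.Aᵀ * X - (Sys.S + X * Sys.B) * pinv Sys.R * (Sys.Sᵀ + Sys.Bᵀ * X) + Sys.Q

/-- `X` is a symmetric solution of the constrained generalised continuous algebraic Riccati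
equation: the generalised Riccati equation together with `ker R ⊆ ker (S + X B)`. -/
structure IsCGCARESolution (X : Matrix (Fin n) (Fin n) ℝ) : Prop where
  isSymm : X.IsSymm
  riccati_eq : Sys.riccati X = 0
  ker_le : LinearMap.ker Sys.R.mulVecLin ≤ LinearMap.ker (Sys.S + X * Sys.B).mulVecLin

/-- `P` solves the generalised Riccati differential equation
`P' + P A + Aᵀ P - (S + P B) R† (Sᵀ + Bᵀ P) + Q = 0` on `(-∞, T]`, with `P(T) = H`
(the derivative is taken entry by entry, and is one-sided at `T`). -/
structure IsGRDESolution (T : ℝ) (H : Matrix (Fin n) (Fin n) ℝ)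
    (P : ℝ → Matrix (Fin n) (Fin n) ℝ) : Prop where
  hasDeriv : ∀ t ∈ Set.Iic T, ∀ i j,
    HasDerivWithinAt (fun s => P s i j) (-(Sys.riccati (P t) i j)) (Set.Iic T) t
  terminal : P T = H

/-- `F = A - B R† Sᵀ`. -/
noncomputable def F : Matrix (Fin n) (Fin n) ℝ := Sys.A - Sys.B * pinv Sys.R * Sys.Sᵀ

/-- The reachability matrix `[B G, F B G, …, F ^ (n - 1) B G]` of the pair `(F, B G)`. -/
noncomputable def reachMatrix : Matrix (Fin n) (Fin n × Fin m) ℝ :=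
  Matrix.of fun i p => (Sys.F ^ (p.1 : ℕ) * (Sys.B * Sys.G)) i p.2

/-- The reachable subspace of the pair `(F, B G)`. -/
noncomputable def reachable : Submodule ℝ (Fin n → ℝ) :=
  LinearMap.range Sys.reachMatrix.mulVecLin

/-- The terminal weight `H' = H - H U (Uᵀ H U)† Uᵀ H`, where `U` is the reachability matrix:
the generalised Schur complement of the block of `H` on the reachable subspace. -/
noncomputable def reducedWeight (H : Matrix (Fin n) (Fin n) ℝ) : Matrix (Fin n) (Fin n) ℝ :=
  H - H * Sys.reachMatrix * pinv (Sys.reachMatrixᵀ * H * Sys.reachMatrix) * Sys.reachMatrixᵀ * H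

/-- Square-integrable functions on `[0, T]`: the regular (impulse-free) inputs. -/
def IsL2 (T : ℝ) (u : ℝ → Fin m → ℝ) : Prop :=
  MemLp u 2 (volume.restrict (Set.Icc 0 T))

/-- `u` is a square-integrable control on `[0, T]`, and `x` is the corresponding (Carathéodory)
solution of `x' = A x + B u`, `x(0) = x₀`, on `[0, T]`. -/
structure IsAdmissible (T : ℝ) (x₀ : Fin n → ℝ) (u : ℝ → Fin m → ℝ) (x : ℝ → Fin n → ℝ) :
    Prop where
  memL2 : IsL2 T u
  continuousOn : ContinuousOn x (Set.Icc 0 T)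
  eq_integral : ∀ t ∈ Set.Icc 0 T,
    x t = x₀ + ∫ s in (0 : ℝ)..t, (Sys.A *ᵥ x s + Sys.B *ᵥ u s)

/-- The performance index
`J_{T,H} = ∫₀ᵀ [xᵀ uᵀ] Π [x; u] dt + x(T)ᵀ H x(T)`. -/
noncomputable def cost (T : ℝ) (H : Matrix (Fin n) (Fin n) ℝ)
    (u : ℝ → Fin m → ℝ) (x : ℝ → Fin n → ℝ) : ℝ :=
  (∫ t in (0 : ℝ)..T, Sum.elim (x t) (u t) ⬝ᵥ (Sys.popov *ᵥ Sum.elim (x t) (u t)))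
    + x T ⬝ᵥ (H *ᵥ x T)

/-- The control `u`, with its state trajectory `x` from `x₀`, minimises `J_{T,H}`. -/
def IsOptimal (T : ℝ) (H : Matrix (Fin n) (Fin n) ℝ) (x₀ : Fin n → ℝ)
    (u : ℝ → Fin m → ℝ) (x : ℝ → Fin n → ℝ) : Prop :=
  Sys.IsAdmissible T x₀ u x ∧
    ∀ u' x', Sys.IsAdmissible T x₀ u' x' → Sys.cost T H u x ≤ Sys.cost T H u' x'

/-- `u(t) = -R† (Sᵀ + Bᵀ P(t)) x(t) + G v(t)` for almost every `t ∈ [0, T]`. -/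
def IsFeedback (T : ℝ) (P : ℝ → Matrix (Fin n) (Fin n) ℝ)
    (u : ℝ → Fin m → ℝ) (x : ℝ → Fin n → ℝ) (v : ℝ → Fin m → ℝ) : Prop :=
  ∀ᵐ t ∂(volume.restrict (Set.Icc 0 T)), u t = -(Sys.gain (P t) *ᵥ x t) + Sys.G *ᵥ v t

end LQSystem

/-! ### Real matrices: semidefinite forms and pseudo-inverses -/

section MatrixLemmas

variable {ι κ : Type*} [Fintype ι] [Fintype κ]

/-! The core is completion of the square. Let `P` solve the Riccati differential equation with a
terminal weight `K ≥ 0` that vanishes on the reachable subspace. If `P B G = 0` along the solution,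
the running cost plus the derivative of `xᵀ P x` equals `(u + gain x)ᵀ R (u + gain x)`. Integrating
(`IsGRDESolution.cost_eq`), `J_{T,K}` is `x₀ᵀ P(0) x₀` plus a nonnegative integral. It is zero
exactly when `u + gain x` lies in `ker R = im G` almost everywhere, which is the feedback form with
free `v`.

Three facts support this. (a) `P B G = 0`: the constrained algebraic equation makes the symmetric
solution `X`, hence `Q₀`, vanish on the reachable subspace (`Q₀_mulVec_eq_zero`). That subspace is
`F`-invariant, so `P` restricted to it solves a homogeneous linear equation with terminal value
zero. (b) `P` exists on all of `(-∞, T]`: it is `Z Y⁻¹` for a linear Hamiltonian system, and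
semidefiniteness of the weights keeps `Y` invertible. (c) Uniqueness is Grönwall's inequality.

For general `H`, the weight `H'` vanishes on the reachable subspace and satisfies `H' ≤ H`, with
equality of the quadratic forms at `y` exactly when `H y` is orthogonal to that subspace. So the
optimal cost for `H'` bounds the cost for `H` from below. The bound is attained: by a Gramian
argument `v` can shift `x(T)` by any reachable vector, in particular to a point where this
orthogonality holds. `IsGRDESolution.verification` combines these facts. -/

theorem Matrix.dotProduct_transpose_mulVec_comm (M : Matrix ι κ ℝ) (x : κ → ℝ) (y : ι → ℝ) :
    x ⬝ᵥ (Mᵀ *ᵥ y) = y ⬝ᵥ (M *ᵥ x) := by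
  rw [dotProduct_mulVec, vecMul_transpose, dotProduct_comm]

theorem Matrix.IsSymm.dotProduct_mulVec_comm {M : Matrix ι ι ℝ} (hM : M.IsSymm) (x y : ι → ℝ) :
    x ⬝ᵥ (M *ᵥ y) = y ⬝ᵥ (M *ᵥ x) := by
  conv_lhs => rw [← hM.eq]
  exact dotProduct_transpose_mulVec_comm M x y

namespace Matrix.PosSemidef

variable {M : Matrix ι ι ℝ}

omit [Fintype ι] in
theorem isSymm_real (hM : M.PosSemidef) : M.IsSymm := by
  have := hM.isHermitian
  rwa [IsHermitian, conjTranspose_eq_transpose_of_trivial] at this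

theorem nonneg_real (hM : M.PosSemidef) (x : ι → ℝ) : 0 ≤ x ⬝ᵥ (M *ᵥ x) := by
  simpa using hM.dotProduct_mulVec_nonneg x

theorem mulVec_eq_zero_real (hM : M.PosSemidef) {x : ι → ℝ} (h : x ⬝ᵥ (M *ᵥ x) = 0) :
    M *ᵥ x = 0 :=
  (hM.dotProduct_mulVec_zero_iff x).1 (by simpa using h)

theorem of_real (h : M.IsSymm) (h' : ∀ x, 0 ≤ x ⬝ᵥ (M *ᵥ x)) : M.PosSemidef :=
  PosSemidef.of_dotProduct_mulVec_nonneg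
    (by rwa [IsHermitian, conjTranspose_eq_transpose_of_trivial]) (by simpa using h')

theorem mul_mul_transpose_real (hM : M.PosSemidef) (C : Matrix κ ι ℝ) :
    (C * M * Cᵀ).PosSemidef := by
  simpa [conjTranspose_eq_transpose_of_trivial] using hM.mul_mul_conjTranspose_same C

theorem transpose_mul_mul_real (hM : M.PosSemidef) (C : Matrix ι κ ℝ) :
    (Cᵀ * M * C).PosSemidef := by
  simpa using hM.mul_mul_transpose_real Cᵀ

end Matrix.PosSemidef

omit [Fintype ι] in
theorem Matrix.ext_mulVec {M N : Matrix ι κ ℝ} (h : ∀ w, M *ᵥ w = N *ᵥ w) : M = N := by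
  classical
  exact Matrix.mulVec_injective (funext h)

section Pinv

variable [DecidableEq κ]

theorem mul_pinv_mul (M : Matrix ι κ ℝ) : M * pinv M * M = M := (pinv_spec M).mul_mul_left

theorem pinv_mul_pinv (M : Matrix ι κ ℝ) : pinv M * M * pinv M = pinv M :=
  (pinv_spec M).mul_mul_right

/-- Transposition preserves the first two Penrose conditions and exchanges the last two, so
uniqueness applies to `(M†)ᵀ`. -/
theorem Matrix.IsSymm.pinv {M : Matrix κ κ ℝ} (hM : M.IsSymm) : (pinv M).IsSymm := by
  have h := pinv_spec M
  refine IsMoorePenroseInverse.unique (M := M) ⟨?_, ?_, ?_, ?_⟩ h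
  · have e := congrArg Matrix.transpose h.mul_mul_left
    rwa [transpose_mul, transpose_mul, hM.eq, ← Matrix.mul_assoc] at e
  · have e := congrArg Matrix.transpose h.mul_mul_right
    rwa [transpose_mul, transpose_mul, hM.eq, ← Matrix.mul_assoc] at e
  · have e := h.isSymm_right.transpose
    rwa [transpose_mul, hM.eq] at e
  · have e := h.isSymm_left.transpose
    rwa [transpose_mul, hM.eq] at e

/-- `M† = M† M M†` is a congruence of `M`, since `M†` is symmetric. -/
theorem Matrix.PosSemidef.pinv {M : Matrix κ κ ℝ} (hM : M.PosSemidef) :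
    (pinv M).PosSemidef := by
  have h := hM.mul_mul_transpose_real (_root_.pinv M)
  rwa [hM.isSymm_real.pinv.eq, pinv_mul_pinv] at h

/-- A matrix whose kernel contains that of `M` factors through `M† M`. -/
theorem mul_pinv_mul_of_ker_le {μ : Type*} [Fintype μ] {M : Matrix ι κ ℝ} {C : Matrix μ κ ℝ}
    (h : ∀ w, M *ᵥ w = 0 → C *ᵥ w = 0) : C * pinv M * M = C := by
  refine Matrix.ext_mulVec fun w => ?_
  have h0 : M *ᵥ (w - (pinv M * M) *ᵥ w) = 0 := by
    rw [mulVec_sub, mulVec_mulVec, ← Matrix.mul_assoc, mul_pinv_mul, sub_self]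
  have h1 := h _ h0
  rw [mulVec_sub, mulVec_mulVec, ← Matrix.mul_assoc, sub_eq_zero] at h1
  exact h1.symm

/-- A vector orthogonal to the kernel of a symmetric matrix lies in its range. -/
theorem Matrix.IsSymm.exists_mulVec_eq {M : Matrix κ κ ℝ} (hM : M.IsSymm) {ξ : κ → ℝ}
    (h : ∀ η, M *ᵥ η = 0 → η ⬝ᵥ ξ = 0) : ∃ η, M *ᵥ η = ξ := by
  have h1 : replicateRow Unit ξ * _root_.pinv M * M = replicateRow Unit ξ := by
    refine mul_pinv_mul_of_ker_le fun w hw => ?_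
    ext i
    simpa [mulVec, dotProduct_comm] using h w hw
  refine ⟨(_root_.pinv M)ᵀ *ᵥ ξ, ?_⟩
  have h2 := congrArg Matrix.transpose h1
  simp only [transpose_mul, hM.eq, transpose_replicateRow] at h2
  ext i
  have h3 := congrFun (congrFun h2 i) ()
  rw [← Matrix.mul_assoc] at h3
  rw [mulVec_mulVec]
  simpa [Matrix.mul_apply, mulVec, dotProduct] using h3

end Pinv

end MatrixLemmas

/-- Cayley–Hamilton: `M ^ n` is a linear combination of lower powers. -/
theorem Matrix.pow_card_mulVec_mem {n : ℕ} (M : Matrix (Fin n) (Fin n) ℝ) (b : Fin n → ℝ)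
    (V : Submodule ℝ (Fin n → ℝ)) (h : ∀ k < n, (M ^ k) *ᵥ b ∈ V) : (M ^ n) *ᵥ b ∈ V := by
  have h1 := Matrix.aeval_self_charpoly M
  have hd : M.charpoly.natDegree = n := by simp [Matrix.charpoly_natDegree_eq_dim]
  rw [Polynomial.aeval_eq_sum_range, Finset.sum_range_succ, M.charpoly_monic.coeff_natDegree, hd,
    one_smul] at h1
  rw [eq_neg_of_add_eq_zero_right h1, neg_mulVec, Matrix.sum_mulVec]
  refine V.neg_mem (V.sum_mem fun k hk => ?_)
  rw [smul_mulVec]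
  exact V.smul_mem _ (h k (Finset.mem_range.1 hk))

/-! ### Algebra of the Popov matrix and the Riccati operator -/

namespace LQSystem

variable {n m : ℕ} (Sys : LQSystem n m)

/-- The input weight `W = B R† Bᵀ` of the Riccati equation. -/
noncomputable def W : Matrix (Fin n) (Fin n) ℝ := Sys.B * pinv Sys.R * Sys.Bᵀ

/-- The state weight `Q - S R† Sᵀ`, the generalised Schur complement of `R` in `Π`. -/
noncomputable def Q₀ : Matrix (Fin n) (Fin n) ℝ := Sys.Q - Sys.S * pinv Sys.R * Sys.Sᵀ

theorem popov_quadratic (x : Fin n → ℝ) (u : Fin m → ℝ) :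
    Sum.elim x u ⬝ᵥ (Sys.popov *ᵥ Sum.elim x u)
      = x ⬝ᵥ (Sys.Q *ᵥ x) + 2 * (x ⬝ᵥ (Sys.S *ᵥ u)) + u ⬝ᵥ (Sys.R *ᵥ u) := by
  rw [popov, fromBlocks_mulVec, sumElim_dotProduct_sumElim]
  simp only [dotProduct_add, Sum.elim_comp_inl, Sum.elim_comp_inr,
    dotProduct_transpose_mulVec_comm]
  ring

theorem A_sub_B_mul_gain (P : Matrix (Fin n) (Fin n) ℝ) :
    Sys.A - Sys.B * Sys.gain P = Sys.F - Sys.W * P := by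
  rw [gain, F, W]
  simp only [Matrix.mul_add, Matrix.mul_assoc]
  abel

theorem R_mul_G : Sys.R * Sys.G = 0 := by
  rw [G, Matrix.mul_sub, Matrix.mul_one, ← Matrix.mul_assoc, mul_pinv_mul, sub_self]

section PopovPosSemidef

variable {Sys} (hPi : Sys.popov.PosSemidef)
include hPi

theorem posSemidef_R : Sys.R.PosSemidef := by
  exact hPi.submatrix (Sum.inr : Fin m → Fin n ⊕ Fin m)

theorem posSemidef_Q : Sys.Q.PosSemidef := by
  exact hPi.submatrix (Sum.inl : Fin n → Fin n ⊕ Fin m)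

/-- The Popov form vanishes at `(0, w)`, so by semidefiniteness `Π` annihilates that vector; its
first block row is `S w`. -/
theorem S_mulVec_eq_zero {w : Fin m → ℝ} (hw : Sys.R *ᵥ w = 0) : Sys.S *ᵥ w = 0 := by
  have h := hPi.mulVec_eq_zero_real (x := Sum.elim 0 w)
    (by rw [popov_quadratic, hw]; simp)
  rw [popov, fromBlocks_mulVec] at h
  ext i
  have := congrFun h (Sum.inl i)
  simpa using this

theorem posSemidef_W : Sys.W.PosSemidef := (posSemidef_R hPi).pinv.mul_mul_transpose_real _

/-- The quadratic form of `Q₀` at `x` is the Popov form at `u = -R† Sᵀ x`. -/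
theorem posSemidef_Q₀ : Sys.Q₀.PosSemidef := by
  have hR := (posSemidef_R hPi).isSymm_real.pinv
  refine PosSemidef.of_real ?_ fun x => ?_
  · rw [IsSymm, Q₀, transpose_sub, (posSemidef_Q hPi).isSymm_real.eq, transpose_mul, transpose_mul,
      transpose_transpose, hR.eq, Matrix.mul_assoc]
  · have h := hPi.nonneg_real (Sum.elim x (-((pinv Sys.R * Sys.Sᵀ) *ᵥ x)))
    rw [popov_quadratic] at h
    convert h using 1
    have e : (pinv Sys.R * Sys.Sᵀ) *ᵥ x ⬝ᵥ (Sys.R *ᵥ ((pinv Sys.R * Sys.Sᵀ) *ᵥ x))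
        = x ⬝ᵥ ((Sys.S * pinv Sys.R * Sys.Sᵀ) *ᵥ x) := by
      rw [dotProduct_comm, ← dotProduct_transpose_mulVec_comm, mulVec_mulVec, mulVec_mulVec,
        transpose_mul, hR.eq, transpose_transpose]
      congr 2
      calc _ = Sys.S * (pinv Sys.R * Sys.R * pinv Sys.R) * Sys.Sᵀ := by
            simp only [Matrix.mul_assoc]
        _ = _ := by rw [pinv_mul_pinv]
    rw [mulVec_neg, mulVec_neg, dotProduct_neg, dotProduct_neg, neg_dotProduct, e, mulVec_mulVec,
      ← Matrix.mul_assoc, Q₀, sub_mulVec, dotProduct_sub]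
    ring

theorem S_mul_G : Sys.S * Sys.G = 0 := by
  refine Matrix.ext_mulVec fun w => ?_
  rw [← mulVec_mulVec, zero_mulVec]
  exact S_mulVec_eq_zero hPi (by rw [mulVec_mulVec, R_mul_G, zero_mulVec])

/-- Absorbing the cross term `S` into `F` and `Q₀` leaves a standard Riccati operator with
semidefinite weights; the Hamiltonian system and the Grönwall estimates use this form. -/
theorem riccati_eq (P : Matrix (Fin n) (Fin n) ℝ) :
    Sys.riccati P = P * Sys.F + Sys.Fᵀ * P - P * Sys.W * P + Sys.Q₀ := by
  rw [riccati, F, W, Q₀, transpose_sub, transpose_mul, transpose_mul, transpose_transpose,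
    (posSemidef_R hPi).isSymm_real.pinv.eq]
  simp only [Matrix.mul_sub, Matrix.sub_mul, Matrix.mul_add, Matrix.add_mul, Matrix.mul_assoc]
  abel

theorem riccati_transpose (P : Matrix (Fin n) (Fin n) ℝ) :
    Sys.riccati Pᵀ = (Sys.riccati P)ᵀ := by
  rw [riccati_eq hPi, riccati_eq hPi]
  simp only [transpose_add, transpose_sub, transpose_mul, transpose_transpose,
    (posSemidef_W hPi).isSymm_real.eq, (posSemidef_Q₀ hPi).isSymm_real.eq, Matrix.mul_assoc]
  abel

/-- Completion of the square in the running cost. -/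
theorem popov_quadratic_add_deriv {P : Matrix (Fin n) (Fin n) ℝ} (hP : P.IsSymm)
    (hG : P * (Sys.B * Sys.G) = 0) (x : Fin n → ℝ) (u : Fin m → ℝ) :
    Sum.elim x u ⬝ᵥ (Sys.popov *ᵥ Sum.elim x u)
        + ((Sys.A *ᵥ x + Sys.B *ᵥ u) ⬝ᵥ (P *ᵥ x) + x ⬝ᵥ (-Sys.riccati P *ᵥ x)
          + x ⬝ᵥ (P *ᵥ (Sys.A *ᵥ x + Sys.B *ᵥ u)))
      = (u + Sys.gain P *ᵥ x) ⬝ᵥ (Sys.R *ᵥ (u + Sys.gain P *ᵥ x)) := by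
  have hR := (posSemidef_R hPi).isSymm_real
  set N := Sys.S + P * Sys.B with hN
  have hNT : Sys.Sᵀ + Sys.Bᵀ * P = Nᵀ := by
    rw [hN, transpose_add, transpose_mul, hP.eq]
  -- `N` vanishes on `ker R = im G`. This makes `R (gain P x) = Nᵀ x`, so that the cross terms fit
  -- into the square.
  have hNG : N * pinv Sys.R * Sys.R = N := by
    have h : N * Sys.G = 0 := by
      rw [hN, Matrix.add_mul, S_mul_G hPi, Matrix.mul_assoc, hG, add_zero]
    rw [G, Matrix.mul_sub, Matrix.mul_one, ← Matrix.mul_assoc, sub_eq_zero] at h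
    exact h.symm
  have hRw : Sys.R *ᵥ (Sys.gain P *ᵥ x) = Nᵀ *ᵥ x := by
    have h := congrArg Matrix.transpose hNG
    rw [transpose_mul, transpose_mul, hR.eq, hR.pinv.eq, ← Matrix.mul_assoc] at h
    rw [gain, hNT, mulVec_mulVec, ← Matrix.mul_assoc, h]
  have hw : x ⬝ᵥ ((N * pinv Sys.R * Nᵀ) *ᵥ x) = (Sys.gain P *ᵥ x) ⬝ᵥ (Nᵀ *ᵥ x) := by
    rw [dotProduct_transpose_mulVec_comm, gain, hNT, mulVec_mulVec, Matrix.mul_assoc]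
  have h1 : x ⬝ᵥ (Sys.riccati P *ᵥ x) = 2 * ((Sys.A *ᵥ x) ⬝ᵥ (P *ᵥ x))
      - (Sys.gain P *ᵥ x) ⬝ᵥ (Nᵀ *ᵥ x) + x ⬝ᵥ (Sys.Q *ᵥ x) := by
    rw [riccati, hNT, ← hN, add_mulVec, sub_mulVec, add_mulVec, dotProduct_add, dotProduct_sub,
      dotProduct_add, hw, ← mulVec_mulVec, ← mulVec_mulVec, dotProduct_transpose_mulVec_comm,
      hP.dotProduct_mulVec_comm x, dotProduct_comm (P *ᵥ x)]
    ring
  have h2 : (Sys.gain P *ᵥ x) ⬝ᵥ (Sys.R *ᵥ u) = u ⬝ᵥ (Nᵀ *ᵥ x) := by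
    rw [hR.dotProduct_mulVec_comm, hRw]
  have h3 : u ⬝ᵥ (Nᵀ *ᵥ x) = x ⬝ᵥ (Sys.S *ᵥ u) + (Sys.B *ᵥ u) ⬝ᵥ (P *ᵥ x) := by
    rw [dotProduct_transpose_mulVec_comm, hN, add_mulVec, dotProduct_add, ← mulVec_mulVec,
      hP.dotProduct_mulVec_comm x]
  rw [popov_quadratic, hP.dotProduct_mulVec_comm x, neg_mulVec, dotProduct_neg, h1, mulVec_add,
    dotProduct_add, add_dotProduct, add_dotProduct, add_dotProduct, hRw, h2, h3]
  ring

end PopovPosSemidef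

/-! ### The reachable subspace -/

theorem mul_reachMatrix_eq_zero_iff {K : Matrix (Fin n) (Fin n) ℝ} :
    K * Sys.reachMatrix = 0 ↔ ∀ ξ ∈ Sys.reachable, K *ᵥ ξ = 0 := by
  constructor
  · rintro h _ ⟨w, rfl⟩
    rw [mulVecLin_apply, mulVec_mulVec, h, zero_mulVec]
  · intro h
    refine Matrix.ext_mulVec fun w => ?_
    rw [← mulVec_mulVec, zero_mulVec]
    exact h _ ⟨w, rfl⟩

theorem reachMatrix_mulVec_single (k : Fin n) (j : Fin m) :
    Sys.reachMatrix *ᵥ Pi.single (k, j) 1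
      = (Sys.F ^ (k : ℕ)) *ᵥ ((Sys.B * Sys.G) *ᵥ Pi.single j 1) := by
  rw [mulVec_mulVec]
  ext i
  simp [reachMatrix]

theorem F_pow_mulVec_mem_reachable_of_lt (k : ℕ) (hk : k < n) (w : Fin m → ℝ) :
    (Sys.F ^ k) *ᵥ ((Sys.B * Sys.G) *ᵥ w) ∈ Sys.reachable := by
  have hw : w = ∑ j, w j • Pi.single j (1 : ℝ) := by
    ext i; simp [Finset.sum_apply, Pi.single_apply]
  rw [hw, mulVec_sum, mulVec_sum]
  refine Submodule.sum_mem _ fun j _ => ?_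
  rw [mulVec_smul, mulVec_smul, ← Sys.reachMatrix_mulVec_single ⟨k, hk⟩ j]
  exact Submodule.smul_mem _ _ ⟨_, rfl⟩

/-- The exponent `n` itself must be included: `F` sends the last generator to it, and invariance
under `F` follows. -/
theorem F_pow_mulVec_mem_reachable_of_le (k : ℕ) (hk : k ≤ n) (w : Fin m → ℝ) :
    (Sys.F ^ k) *ᵥ ((Sys.B * Sys.G) *ᵥ w) ∈ Sys.reachable := by
  rcases hk.lt_or_eq with h | rfl
  · exact Sys.F_pow_mulVec_mem_reachable_of_lt k h w
  · exact Matrix.pow_card_mulVec_mem _ _ _ fun k hk =>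
      Sys.F_pow_mulVec_mem_reachable_of_lt k hk w

/-- The reachable subspace lies in every subspace containing the generators `Fᵏ B G w`. -/
theorem reachable_le {V : Submodule ℝ (Fin n → ℝ)}
    (h : ∀ k < n, ∀ w, (Sys.F ^ k) *ᵥ ((Sys.B * Sys.G) *ᵥ w) ∈ V) : Sys.reachable ≤ V := by
  rintro _ ⟨w, rfl⟩
  have hw : w = ∑ p, w p • Pi.single p (1 : ℝ) := by
    ext i; simp [Finset.sum_apply, Pi.single_apply]
  rw [mulVecLin_apply, hw, mulVec_sum]
  refine Submodule.sum_mem _ fun p _ => ?_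
  rw [mulVec_smul, Sys.reachMatrix_mulVec_single p.1 p.2]
  exact Submodule.smul_mem _ _ (h _ p.1.2 _)

theorem F_mulVec_mem_reachable {ξ : Fin n → ℝ} (hξ : ξ ∈ Sys.reachable) :
    Sys.F *ᵥ ξ ∈ Sys.reachable := by
  have : Sys.reachable ≤ Sys.reachable.comap Sys.F.mulVecLin := by
    refine Sys.reachable_le fun k hk w => ?_
    rw [Submodule.mem_comap, mulVecLin_apply, mulVec_mulVec, ← pow_succ']
    exact Sys.F_pow_mulVec_mem_reachable_of_le (k + 1) hk w
  exact this hξ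

theorem F_pow_mulVec_mem_reachable (k : ℕ) (w : Fin m → ℝ) :
    (Sys.F ^ k) *ᵥ ((Sys.B * Sys.G) *ᵥ w) ∈ Sys.reachable := by
  induction k with
  | zero => exact Sys.F_pow_mulVec_mem_reachable_of_le 0 (Nat.zero_le _) w
  | succ k ih =>
    rw [pow_succ', ← mulVec_mulVec]
    exact Sys.F_mulVec_mem_reachable ih

theorem B_mul_G_mulVec_mem_reachable (w : Fin m → ℝ) :
    (Sys.B * Sys.G) *ᵥ w ∈ Sys.reachable := by
  simpa using Sys.F_pow_mulVec_mem_reachable 0 w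

variable {Sys} in
/-- Solvability of the constrained Riccati equation makes the reachable subspace cost-free. -/
theorem Q₀_mulVec_eq_zero (hPi : Sys.popov.PosSemidef) {X : Matrix (Fin n) (Fin n) ℝ}
    (hX : Sys.IsCGCARESolution X) {ξ : Fin n → ℝ} (hξ : ξ ∈ Sys.reachable) :
    Sys.Q₀ *ᵥ ξ = 0 := by
  have hric := hX.riccati_eq
  rw [riccati_eq hPi] at hric
  -- On `ker X` the Riccati equation reads `X F ξ + Q₀ ξ = 0`. Pairing with `ξ` removes the first
  -- term, and `Q₀ ≥ 0` gives `Q₀ ξ = 0`. Thus `ker X` is `F`-invariant and lies in `ker Q₀`.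
  have key : ∀ ξ, X *ᵥ ξ = 0 → Sys.Q₀ *ᵥ ξ = 0 ∧ X *ᵥ (Sys.F *ᵥ ξ) = 0 := by
    intro ξ hξ
    have h1 : X *ᵥ (Sys.F *ᵥ ξ) + Sys.Q₀ *ᵥ ξ = 0 := by
      have h := congrArg (· *ᵥ ξ) hric
      simpa only [add_mulVec, sub_mulVec, ← mulVec_mulVec, hξ, mulVec_zero, add_zero, sub_zero,
        zero_mulVec] using h
    have h2 : Sys.Q₀ *ᵥ ξ = 0 := by
      refine (posSemidef_Q₀ hPi).mulVec_eq_zero_real ?_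
      have h := congrArg (ξ ⬝ᵥ ·) h1
      simp only [dotProduct_add, dotProduct_zero] at h
      rwa [hX.isSymm.dotProduct_mulVec_comm ξ, hξ, dotProduct_zero, zero_add] at h
    exact ⟨h2, by simpa [h2] using h1⟩
  have hV : ∀ k w, X *ᵥ ((Sys.F ^ k) *ᵥ ((Sys.B * Sys.G) *ᵥ w)) = 0 := by
    intro k w
    induction k with
    | zero =>
      -- The kernel constraint gives `(S + X B) G = 0`, and `S G = 0` already, so `X B G = 0`.
      have h := hX.ker_le (x := Sys.G *ᵥ w)
        (by simp [mulVec_mulVec, R_mul_G])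
      rw [LinearMap.mem_ker, mulVecLin_apply, add_mulVec, mulVec_mulVec, S_mul_G hPi,
        zero_mulVec, zero_add] at h
      simpa [mulVec_mulVec, Matrix.mul_assoc] using h
    | succ k ih =>
      rw [pow_succ', ← mulVec_mulVec]
      exact (key _ ih).2
  have : Sys.reachable ≤ LinearMap.ker X.mulVecLin :=
    Sys.reachable_le fun k _ w => by simpa using hV k w
  exact (key ξ (by simpa using this hξ)).1

/-! ### The reduced terminal weight as a Schur complement -/

section ReducedWeight

variable {H : Matrix (Fin n) (Fin n) ℝ} (hH : H.PosSemidef)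
include hH

/-- If `Uᵀ H U w = 0`, the form of `H` vanishes at `U w`, hence `H U w = 0`; so `H U` factors
through `Uᵀ H U`. -/
theorem weight_mul_pinv_mul :
    H * Sys.reachMatrix * pinv (Sys.reachMatrixᵀ * H * Sys.reachMatrix)
      * (Sys.reachMatrixᵀ * H * Sys.reachMatrix) = H * Sys.reachMatrix := by
  refine mul_pinv_mul_of_ker_le fun w hw => ?_
  rw [← mulVec_mulVec]
  refine hH.mulVec_eq_zero_real ?_
  have h := congrArg (w ⬝ᵥ ·) hw
  simp only [Matrix.mul_assoc, ← mulVec_mulVec, dotProduct_zero,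
    dotProduct_transpose_mulVec_comm] at h
  rwa [dotProduct_comm]

/-- `H' = Eᵀ H E` with `E = 1 - U (Uᵀ H U)† Uᵀ H`. -/
theorem posSemidef_reducedWeight : (Sys.reducedWeight H).PosSemidef := by
  set M := Sys.reachMatrixᵀ * H * Sys.reachMatrix with hM
  have hMs := (hH.transpose_mul_mul_real Sys.reachMatrix).isSymm_real.pinv
  rw [← hM] at hMs
  set E := 1 - Sys.reachMatrix * pinv M * Sys.reachMatrixᵀ * H with hE
  have h := hH.transpose_mul_mul_real E
  convert h using 1
  have hEt : Eᵀ = 1 - H * Sys.reachMatrix * pinv M * Sys.reachMatrixᵀ := by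
    rw [hE]
    simp only [transpose_sub, transpose_one, transpose_mul, transpose_transpose,
      hH.isSymm_real.eq, hMs.eq, Matrix.mul_assoc]
  have h2 : H * Sys.reachMatrix * pinv M * Sys.reachMatrixᵀ * H
      * (Sys.reachMatrix * pinv M * Sys.reachMatrixᵀ * H)
      = H * Sys.reachMatrix * pinv M * Sys.reachMatrixᵀ * H := by
    calc _ = H * Sys.reachMatrix * (pinv M * M * pinv M) * Sys.reachMatrixᵀ * H := by
          rw [hM]; simp only [Matrix.mul_assoc]
      _ = _ := by rw [pinv_mul_pinv]
  rw [hEt, hE, Matrix.sub_mul, Matrix.one_mul, Matrix.mul_sub, Matrix.mul_one, Matrix.sub_mul, h2,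
    reducedWeight, ← hM]
  simp only [Matrix.mul_assoc, sub_self, sub_zero]

theorem reducedWeight_mul_reachMatrix : Sys.reducedWeight H * Sys.reachMatrix = 0 := by
  have h := Sys.weight_mul_pinv_mul hH
  rw [reducedWeight, Matrix.sub_mul]
  simp only [Matrix.mul_assoc] at h ⊢
  rw [h, sub_self]

theorem quadratic_weight_eq (x : Fin n → ℝ) :
    x ⬝ᵥ (H *ᵥ x) = x ⬝ᵥ (Sys.reducedWeight H *ᵥ x)
      + (Sys.reachMatrixᵀ *ᵥ (H *ᵥ x)) ⬝ᵥ (pinv (Sys.reachMatrixᵀ * H * Sys.reachMatrix)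
        *ᵥ (Sys.reachMatrixᵀ *ᵥ (H *ᵥ x))) := by
  set M := Sys.reachMatrixᵀ * H * Sys.reachMatrix with hM
  have e : x ⬝ᵥ ((H * Sys.reachMatrix * pinv M * Sys.reachMatrixᵀ * H) *ᵥ x)
      = (Sys.reachMatrixᵀ *ᵥ (H *ᵥ x)) ⬝ᵥ (pinv M *ᵥ (Sys.reachMatrixᵀ *ᵥ (H *ᵥ x))) := by
    simp only [Matrix.mul_assoc, ← mulVec_mulVec]
    rw [hH.isSymm_real.dotProduct_mulVec_comm, dotProduct_comm,
      ← dotProduct_transpose_mulVec_comm, dotProduct_comm]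
  rw [reducedWeight, sub_mulVec, dotProduct_sub, e]
  ring

theorem quadratic_reducedWeight_le (x : Fin n → ℝ) :
    x ⬝ᵥ (Sys.reducedWeight H *ᵥ x) ≤ x ⬝ᵥ (H *ᵥ x) := by
  rw [Sys.quadratic_weight_eq hH x]
  have := (hH.transpose_mul_mul_real Sys.reachMatrix).pinv.nonneg_real
    (Sys.reachMatrixᵀ *ᵥ (H *ᵥ x))
  linarith

/-- The gap between the two forms is `zᵀ M† z` with `z = Uᵀ H x` and `M = Uᵀ H U`. If it is zero
then `M† z = 0`, and `z = M M† z` because `M M† Uᵀ H = Uᵀ H`. -/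
theorem quadratic_reducedWeight_eq_iff (x : Fin n → ℝ) :
    x ⬝ᵥ (Sys.reducedWeight H *ᵥ x) = x ⬝ᵥ (H *ᵥ x) ↔
      ∀ ξ ∈ Sys.reachable, ξ ⬝ᵥ (H *ᵥ x) = 0 := by
  have hMp := hH.transpose_mul_mul_real Sys.reachMatrix
  have hU : (∀ ξ ∈ Sys.reachable, ξ ⬝ᵥ (H *ᵥ x) = 0) ↔ Sys.reachMatrixᵀ *ᵥ (H *ᵥ x) = 0 := by
    constructor
    · intro h
      refine dotProduct_eq_zero _ fun w => ?_
      rw [dotProduct_comm, dotProduct_transpose_mulVec_comm, dotProduct_comm]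
      exact h _ ⟨w, rfl⟩
    · rintro h _ ⟨w, rfl⟩
      rw [mulVecLin_apply, dotProduct_comm, ← dotProduct_transpose_mulVec_comm, h, dotProduct_zero]
  rw [hU, Sys.quadratic_weight_eq hH x, eq_comm, add_eq_left]
  constructor
  · intro h
    have h1 := hMp.pinv.mulVec_eq_zero_real h
    have h2 := congrArg Matrix.transpose (Sys.weight_mul_pinv_mul hH)
    rw [transpose_mul, hMp.isSymm_real.eq, transpose_mul, hMp.isSymm_real.pinv.eq, transpose_mul,
      hH.isSymm_real.eq] at h2
    rw [mulVec_mulVec, mulVec_mulVec, Matrix.mul_assoc] at h1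
    rw [mulVec_mulVec, ← h2, ← mulVec_mulVec, h1, mulVec_zero]
  · intro h
    rw [h, zero_dotProduct]

end ReducedWeight

end LQSystem

/-! ### Backward Grönwall inequality -/

section ODE

open Set

/-- Backward Grönwall: a solution of a homogeneous linear differential inequality that vanishes at
the right end point vanishes identically. -/
theorem eq_zero_of_norm_deriv_le_mul_norm_of_eq_zero_left {E : Type*} [NormedAddCommGroup E]
    [NormedSpace ℝ E] {f f' : ℝ → E} {K a b : ℝ}
    (hf : ∀ t ∈ Icc a b, HasDerivWithinAt f (f' t) (Iic b) t) (hb : f b = 0)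
    (bound : ∀ t ∈ Icc a b, ‖f' t‖ ≤ K * ‖f t‖) : ∀ t ∈ Icc a b, f t = 0 := by
  have hneg : ∀ s ∈ Icc (-b) (-a), -s ∈ Icc a b := fun s hs =>
    ⟨by linarith [hs.2], by linarith [hs.1]⟩
  have hd : ∀ s ∈ Icc (-b) (-a), HasDerivWithinAt (fun s => f (-s)) (-f' (-s)) (Ici (-b)) s := by
    intro s hs
    have h := (hf (-s) (hneg s hs)).scomp (h := fun s : ℝ => -s) (h' := -1) (s := Ici (-b)) s
      (hasDerivAt_neg s).hasDerivWithinAt (fun r hr => by simp only [mem_Iic, mem_Ici] at *; linarith)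
    simpa [Function.comp_def] using h
  have h := eq_zero_of_abs_deriv_le_mul_abs_self_of_eq_zero_right (f := fun s => f (-s))
    (f' := fun s => -f' (-s)) (K := K) (a := -b) (b := -a)
    (fun s hs => ((hd s hs).continuousWithinAt).mono Icc_subset_Ici_self)
    (fun s hs => (hd s (Ico_subset_Icc_self hs)).mono (Ici_subset_Ici.2 hs.1))
    (by simpa using hb)
    (fun s hs => by simpa using bound (-s) (hneg s (Ico_subset_Icc_self hs)))
  intro t ht
  simpa using h (-t) ⟨by linarith [ht.2], by linarith [ht.1]⟩

end ODE

/-! ### Matrix differential equations and the Hamiltonian system -/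

section MatrixDeriv

attribute [local instance] Matrix.linftyOpNormedRing Matrix.linftyOpNormedAlgebra

variable {ι κ μ : Type*} [Fintype ι] [Fintype κ] [Fintype μ] [DecidableEq ι] [DecidableEq κ]

theorem LinearMap.comp_hasDerivWithinAt_matrix {E : Type*} [NormedAddCommGroup E] [NormedSpace ℝ E]
    (L : Matrix ι ι ℝ →ₗ[ℝ] E) {f : ℝ → Matrix ι ι ℝ} {f' : Matrix ι ι ℝ} {s : Set ℝ} {t : ℝ}
    (h : HasDerivWithinAt f f' s t) : HasDerivWithinAt (fun r => L (f r)) (L f') s t :=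
  (LinearMap.toContinuousLinearMap L).hasFDerivAt.comp_hasDerivWithinAt t h

/-- Passes between the entrywise derivatives of `IsGRDESolution` and derivatives in the local
operator norm, where the exponential, inversion and Grönwall are available. -/
theorem hasDerivWithinAt_matrix_iff {f : ℝ → Matrix ι ι ℝ} {f' : Matrix ι ι ℝ} {s : Set ℝ} {t : ℝ} :
    HasDerivWithinAt f f' s t ↔ ∀ i j, HasDerivWithinAt (fun r => f r i j) (f' i j) s t := by
  constructor
  · intro h i j
    exact (Matrix.entryLinearMap ℝ ℝ i j).comp_hasDerivWithinAt_matrix h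
  · intro h
    have e : ∀ M : Matrix ι ι ℝ, M = ∑ i, ∑ j, M i j • Matrix.single i j (1 : ℝ) := by
      intro M
      conv_lhs => rw [Matrix.matrix_eq_sum_single M]
      simp
    rw [e f', show f = fun r => ∑ i, ∑ j, f r i j • Matrix.single i j (1 : ℝ) from
      funext fun r => e (f r)]
    exact HasDerivWithinAt.fun_sum fun i _ => HasDerivWithinAt.fun_sum fun j _ =>
      (h i j).smul_const _

theorem HasDerivAt.matrix_inv {Y : ℝ → Matrix ι ι ℝ} {Y' : Matrix ι ι ℝ} {t : ℝ}
    (hY : HasDerivAt Y Y' t) (hu : IsUnit (Y t)) :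
    HasDerivAt (fun s => (Y s)⁻¹) (-((Y t)⁻¹ * Y' * (Y t)⁻¹)) t := by
  obtain ⟨u, hu⟩ := hu
  have h := hasFDerivAt_ringInverse (𝕜 := ℝ) u
  rw [hu] at h
  have h2 := h.comp_hasDerivAt t hY
  have e : ((u⁻¹ : (Matrix ι ι ℝ)ˣ) : Matrix ι ι ℝ) = (Y t)⁻¹ := by
    rw [← hu, Matrix.coe_units_inv]
  simp only [Function.comp_def, ← Matrix.nonsing_inv_eq_ringInverse, e, _root_.neg_apply,
    ContinuousLinearMap.mulLeftRight_apply] at h2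
  exact h2

/-- The linear Hamiltonian system attached to a Riccati equation, solved backwards from `T`. -/
theorem exists_hamiltonian_solution (F W Q K : Matrix ι ι ℝ) (T : ℝ) :
    ∃ Y Z : ℝ → Matrix ι ι ℝ, Y T = 1 ∧ Z T = K ∧
      (∀ t, HasDerivAt Y (F * Y t - W * Z t) t) ∧
      ∀ t, HasDerivAt Z (-(Q * Y t) - Fᵀ * Z t) t := by
  set M : Matrix (ι ⊕ ι) (ι ⊕ ι) ℝ := fromBlocks F (-W) (-Q) (-Fᵀ) with hM
  set E : ℝ → Matrix (ι ⊕ ι) (ι ⊕ ι) ℝ := fun t => NormedSpace.exp ((t - T) • M) with hE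
  have hE' : ∀ t, HasDerivAt E (M * E t) t := by
    intro t
    have h := hasDerivAt_exp_smul_const' M (t - T)
    exact h.comp_sub_const t T
  -- `L₁` and `L₂` take the two blocks of `X` times the column `[1; K]`, so `E T = 1` yields the
  -- terminal values `1` and `K`.
  let L₁ : Matrix (ι ⊕ ι) (ι ⊕ ι) ℝ →ₗ[ℝ] Matrix ι ι ℝ :=
    { toFun := fun X => X.toBlocks₁₁ + X.toBlocks₁₂ * K
      map_add' := fun X X' => by
        ext i j
        simp [toBlocks₁₁, toBlocks₁₂, Matrix.mul_apply, add_mul, Finset.sum_add_distrib]; ring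
      map_smul' := fun c X => by
        ext i j
        simp [toBlocks₁₁, toBlocks₁₂, Matrix.mul_apply, mul_assoc, Finset.mul_sum, mul_add] }
  let L₂ : Matrix (ι ⊕ ι) (ι ⊕ ι) ℝ →ₗ[ℝ] Matrix ι ι ℝ :=
    { toFun := fun X => X.toBlocks₂₁ + X.toBlocks₂₂ * K
      map_add' := fun X X' => by
        ext i j
        simp [toBlocks₂₁, toBlocks₂₂, Matrix.mul_apply, add_mul, Finset.sum_add_distrib]; ring
      map_smul' := fun c X => by
        ext i j
        simp [toBlocks₂₁, toBlocks₂₂, Matrix.mul_apply, mul_assoc, Finset.mul_sum, mul_add] }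
  have hL : ∀ X, L₁ (M * X) = F * L₁ X - W * L₂ X ∧ L₂ (M * X) = -(Q * L₁ X) - Fᵀ * L₂ X := by
    intro X
    have e : M * X = fromBlocks (F * X.toBlocks₁₁ + -W * X.toBlocks₂₁)
        (F * X.toBlocks₁₂ + -W * X.toBlocks₂₂) (-Q * X.toBlocks₁₁ + -Fᵀ * X.toBlocks₂₁)
        (-Q * X.toBlocks₁₂ + -Fᵀ * X.toBlocks₂₂) := by
      conv_lhs => rw [← fromBlocks_toBlocks X, hM, fromBlocks_multiply]
    rw [e]
    simp only [L₁, L₂, LinearMap.coe_mk, AddHom.coe_mk, toBlocks_fromBlocks₁₁,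
      toBlocks_fromBlocks₁₂, toBlocks_fromBlocks₂₁, toBlocks_fromBlocks₂₂, Matrix.mul_add,
      Matrix.add_mul, Matrix.neg_mul, Matrix.mul_assoc]
    exact ⟨by abel, by abel⟩
  have hT : E T = 1 := by simp [hE]
  refine ⟨fun t => L₁ (E t), fun t => L₂ (E t), ?_, ?_, fun t => ?_, fun t => ?_⟩
  · simp only [hT, L₁, LinearMap.coe_mk, AddHom.coe_mk]
    rw [← fromBlocks_one, toBlocks_fromBlocks₁₁, toBlocks_fromBlocks₁₂, Matrix.zero_mul, add_zero]
  · simp only [hT, L₂, LinearMap.coe_mk, AddHom.coe_mk]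
    rw [← fromBlocks_one, toBlocks_fromBlocks₂₁, toBlocks_fromBlocks₂₂, Matrix.one_mul, zero_add]
  · rw [← (hL (E t)).1]
    exact (LinearMap.toContinuousLinearMap L₁).hasFDerivAt.comp_hasDerivAt t (hE' t)
  · rw [← (hL (E t)).2]
    exact (LinearMap.toContinuousLinearMap L₂).hasFDerivAt.comp_hasDerivAt t (hE' t)

omit [DecidableEq ι] in
theorem HasDerivAt.dotProduct {f g : ℝ → ι → ℝ} {f' g' : ι → ℝ} {t : ℝ} (hf : HasDerivAt f f' t)
    (hg : HasDerivAt g g' t) :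
    HasDerivAt (fun s => f s ⬝ᵥ g s) (f' ⬝ᵥ g t + f t ⬝ᵥ g') t := by
  simp only [_root_.dotProduct, ← Finset.sum_add_distrib]
  exact HasDerivAt.fun_sum fun i _ => (hasDerivAt_pi.1 hf i).mul (hasDerivAt_pi.1 hg i)

theorem HasDerivAt.mulVec_const {Y : ℝ → Matrix ι ι ℝ} {Y' : Matrix ι ι ℝ} {t : ℝ}
    (hY : HasDerivAt Y Y' t) (w : ι → ℝ) : HasDerivAt (fun s => Y s *ᵥ w) (Y' *ᵥ w) t := by
  have h := ((Matrix.mulVecBilin ℝ ℝ).flip w).comp_hasDerivWithinAt_matrix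
    (hY.hasDerivWithinAt (s := Set.univ))
  exact h.hasDerivAt Filter.univ_mem

/-- The state block of the Hamiltonian flow stays invertible backwards in time when all weights
are positive semidefinite. -/
theorem isUnit_of_hamiltonian_solution {F W Q K : Matrix ι ι ℝ} (hW : W.PosSemidef)
    (hQ : Q.PosSemidef) (hK : K.PosSemidef) {T : ℝ} {Y Z : ℝ → Matrix ι ι ℝ} (hYT : Y T = 1)
    (hZT : Z T = K) (hY : ∀ t, HasDerivAt Y (F * Y t - W * Z t) t)
    (hZ : ∀ t, HasDerivAt Z (-(Q * Y t) - Fᵀ * Z t) t) {t₀ : ℝ} (ht₀ : t₀ ≤ T) :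
    IsUnit (Y t₀) := by
  rw [← Matrix.mulVec_injective_iff_isUnit, ← Matrix.coe_mulVecLin]
  refine (injective_iff_map_eq_zero _).2 fun w hw => ?_
  rw [mulVecLin_apply] at hw
  rcases ht₀.eq_or_lt with rfl | hlt
  · simpa [hYT] using hw
  -- The terms in `F` cancel, so `(Y w) ⬝ᵥ (Z w)` decreases. It is zero at `t₀` and equals `wᵀ K w ≥
  -- 0` at `T`, hence it vanishes on the whole interval.
  have hg : ∀ t, HasDerivAt (fun s => (Y s *ᵥ w) ⬝ᵥ (Z s *ᵥ w))
      (-((Z t *ᵥ w) ⬝ᵥ (W *ᵥ (Z t *ᵥ w))) - (Y t *ᵥ w) ⬝ᵥ (Q *ᵥ (Y t *ᵥ w))) t := by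
    intro t
    convert ((hY t).mulVec_const w).dotProduct ((hZ t).mulVec_const w) using 1
    simp only [sub_mulVec, neg_mulVec, ← mulVec_mulVec, sub_dotProduct, dotProduct_sub,
      dotProduct_neg, dotProduct_transpose_mulVec_comm]
    rw [dotProduct_comm (W *ᵥ _), dotProduct_comm (F *ᵥ _)]
    ring
  have hanti : Antitone (fun s => (Y s *ᵥ w) ⬝ᵥ (Z s *ᵥ w)) :=
    antitone_of_deriv_nonpos (fun t => (hg t).differentiableAt) fun t => by
      rw [(hg t).deriv]
      have := hW.nonneg_real (Z t *ᵥ w)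
      have := hQ.nonneg_real (Y t *ᵥ w)
      linarith
  have hzero : ∀ t ∈ Set.Icc t₀ T, (Y t *ᵥ w) ⬝ᵥ (Z t *ᵥ w) = 0 := by
    intro t ht
    have h1 := hanti ht.1
    have h2 := hanti ht.2
    have h3 := hK.nonneg_real w
    simp only [hw, zero_dotProduct, hYT, hZT, one_mulVec] at h1 h2
    linarith
  have hWZ : ∀ t ∈ Set.Icc t₀ T, W *ᵥ (Z t *ᵥ w) = 0 := by
    intro t ht
    have h0 : HasDerivWithinAt (fun s => (Y s *ᵥ w) ⬝ᵥ (Z s *ᵥ w)) 0 (Set.Icc t₀ T) t :=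
      (hasDerivWithinAt_const t _ (0 : ℝ)).congr hzero (hzero t ht)
    have h1 := (uniqueDiffOn_Icc hlt t ht).eq_deriv _ (hg t).hasDerivWithinAt h0
    have h2 := hW.nonneg_real (Z t *ᵥ w)
    have h3 := hQ.nonneg_real (Y t *ᵥ w)
    exact hW.mulVec_eq_zero_real (by linarith)
  -- With `W Z w = 0` the curve `Y w` solves `y' = F y` from `y(t₀) = 0`; it stays zero up to `T`,
  -- where it equals `w`.
  have hy := eq_zero_of_abs_deriv_le_mul_abs_self_of_eq_zero_right (f := fun s => Y s *ᵥ w)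
    (f' := fun s => F *ᵥ (Y s *ᵥ w)) (K := ‖F‖) (a := t₀) (b := T)
    (fun t _ => ((hY t).mulVec_const w).continuousAt.continuousWithinAt)
    (fun t ht => by
      have h := (hY t).mulVec_const w
      rw [sub_mulVec, ← mulVec_mulVec, ← mulVec_mulVec, hWZ t (Set.Ico_subset_Icc_self ht),
        sub_zero] at h
      exact h.hasDerivWithinAt)
    hw (fun t _ => Matrix.linfty_opNorm_mulVec F _)
  simpa [hYT] using hy T ⟨ht₀, le_rfl⟩

end MatrixDeriv

/-! ### The Riccati differential equation -/

namespace LQSystem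

attribute [local instance] Matrix.linftyOpNormedRing Matrix.linftyOpNormedAlgebra

variable {n m : ℕ} {Sys : LQSystem n m} {T : ℝ} {K : Matrix (Fin n) (Fin n) ℝ}
  {P : ℝ → Matrix (Fin n) (Fin n) ℝ}

theorem IsGRDESolution.hasDerivWithinAt (h : Sys.IsGRDESolution T K P) {t : ℝ} (ht : t ≤ T) :
    HasDerivWithinAt P (-Sys.riccati (P t)) (Set.Iic T) t :=
  hasDerivWithinAt_matrix_iff.2 fun i j => h.hasDeriv t ht i j

theorem IsGRDESolution.exists_norm_bound (h : Sys.IsGRDESolution T K P) (a : ℝ) :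
    ∃ C, ∀ t ∈ Set.Icc a T, ‖P t‖ ≤ C :=
  isCompact_Icc.exists_bound_of_continuousOn fun _ ht =>
    ((h.hasDerivWithinAt ht.2).continuousWithinAt).mono Set.Icc_subset_Iic_self

/-- The difference of two solutions satisfies a linear equation whose coefficients involve both of
them; these are bounded on each `[a, T]`, so Grönwall applies although the equation is quadratic. -/
theorem IsGRDESolution.eqOn (hPi : Sys.popov.PosSemidef) {P' : ℝ → Matrix (Fin n) (Fin n) ℝ}
    (h : Sys.IsGRDESolution T K P) (h' : Sys.IsGRDESolution T K P') :
    Set.EqOn P' P (Set.Iic T) := by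
  intro a ha
  obtain ⟨C, hC⟩ := h.exists_norm_bound a
  obtain ⟨C', hC'⟩ := h'.exists_norm_bound a
  have key := eq_zero_of_norm_deriv_le_mul_norm_of_eq_zero_left (f := fun t => P' t - P t)
    (f' := fun t => -Sys.riccati (P' t) - -Sys.riccati (P t)) (a := a) (b := T)
    (K := ‖Sys.F‖ + ‖Sys.Fᵀ‖ + ‖Sys.W‖ * C + C' * ‖Sys.W‖)
    (fun t ht => (h'.hasDerivWithinAt ht.2).sub (h.hasDerivWithinAt ht.2))
    (by simp only [h'.terminal, h.terminal, sub_self]) (fun t ht => by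
      set D := P' t - P t with hD
      have e : -Sys.riccati (P' t) - -Sys.riccati (P t)
          = D * Sys.W * P t + P' t * Sys.W * D - D * Sys.F - Sys.Fᵀ * D := by
        rw [riccati_eq hPi, riccati_eq hPi, hD]
        simp only [Matrix.mul_sub, Matrix.sub_mul]
        abel
      have h1 : ‖D * Sys.W * P t‖ ≤ ‖D‖ * ‖Sys.W‖ * C :=
        (norm_mul_le _ _).trans (mul_le_mul (norm_mul_le _ _) (hC t ht) (norm_nonneg _)
          (by positivity))
      have h2 : ‖P' t * Sys.W * D‖ ≤ C' * ‖Sys.W‖ * ‖D‖ :=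
        (norm_mul_le _ _).trans (mul_le_mul_of_nonneg_right ((norm_mul_le _ _).trans
          (mul_le_mul_of_nonneg_right (hC' t ht) (norm_nonneg _))) (norm_nonneg _))
      have h3 := norm_mul_le D Sys.F
      have h4 := norm_mul_le Sys.Fᵀ D
      rw [e]
      refine (norm_sub_le _ _).trans ?_
      have h5 := norm_sub_le (D * Sys.W * P t + P' t * Sys.W * D) (D * Sys.F)
      have h6 := norm_add_le (D * Sys.W * P t) (P' t * Sys.W * D)
      linarith)
  exact sub_eq_zero.1 (key a ⟨le_rfl, ha⟩)

/-- The transpose solves the same terminal value problem, so uniqueness applies. -/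
theorem IsGRDESolution.isSymm (hPi : Sys.popov.PosSemidef) (hK : K.IsSymm)
    (h : Sys.IsGRDESolution T K P) {t : ℝ} (ht : t ≤ T) : (P t).IsSymm := by
  refine h.eqOn hPi (P' := fun s => (P s)ᵀ) ⟨fun s hs i j => ?_, by rw [h.terminal, hK.eq]⟩ ht
  rw [riccati_transpose hPi]
  exact h.hasDeriv s hs j i

/-- A terminal weight that vanishes on the reachable subspace forces the whole solution to. -/
theorem IsGRDESolution.mulVec_eq_zero (hPi : Sys.popov.PosSemidef)
    (hX : ∃ X, Sys.IsCGCARESolution X) (hK : ∀ ξ ∈ Sys.reachable, K *ᵥ ξ = 0)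
    (h : Sys.IsGRDESolution T K P) {a : ℝ} (ha : a ≤ T) {ξ : Fin n → ℝ} (hξ : ξ ∈ Sys.reachable) :
    P a *ᵥ ξ = 0 := by
  obtain ⟨X, hX⟩ := hX
  set U := Sys.reachMatrix with hU
  -- A projector onto the reachable subspace; the claim becomes `P Θ = 0`.
  set Θ := U * pinv U with hΘ
  have hΘU : Θ * U = U := mul_pinv_mul U
  have hmem : ∀ w, Θ *ᵥ w ∈ Sys.reachable := fun w => ⟨pinv U *ᵥ w, by simp [hΘ, hU]⟩
  have hfix : ∀ ζ ∈ Sys.reachable, Θ *ᵥ ζ = ζ := by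
    rintro _ ⟨w, rfl⟩
    rw [mulVecLin_apply, mulVec_mulVec, hΘU]
  have hF : Θ * (Sys.F * Θ) = Sys.F * Θ := Matrix.ext_mulVec fun w => by
    rw [← mulVec_mulVec, hfix]
    rw [← mulVec_mulVec]
    exact Sys.F_mulVec_mem_reachable (hmem w)
  have hQ : Sys.Q₀ * Θ = 0 := Matrix.ext_mulVec fun w => by
    rw [← mulVec_mulVec, zero_mulVec, Q₀_mulVec_eq_zero hPi hX (hmem w)]
  obtain ⟨C, hC⟩ := h.exists_norm_bound a
  have key := eq_zero_of_norm_deriv_le_mul_norm_of_eq_zero_left (f := fun t => P t * Θ)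
    (f' := fun t => -Sys.riccati (P t) * Θ) (a := a) (b := T)
    (K := ‖Sys.F * Θ‖ + ‖Sys.Fᵀ‖ + C * ‖Sys.W‖)
    (fun t ht => (h.hasDerivWithinAt ht.2).mul_const Θ)
    (by
      simp only [h.terminal]
      refine Matrix.ext_mulVec fun w => ?_
      rw [← mulVec_mulVec, hK _ (hmem w), zero_mulVec])
    (fun t ht => by
      set D := P t * Θ with hD
      -- Invariance gives `P F Θ = (P Θ) (F Θ)`, and `Q₀ Θ = 0` removes the source term, so the
      -- equation is homogeneous in `D`.
      have e : -Sys.riccati (P t) * Θ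
          = P t * Sys.W * D - D * (Sys.F * Θ) - Sys.Fᵀ * D := by
        rw [riccati_eq hPi, hD, Matrix.mul_assoc (P t) Θ, hF]
        simp only [Matrix.neg_mul, Matrix.add_mul, Matrix.sub_mul, hQ, Matrix.mul_assoc]
        abel
      have h2 : ‖P t * Sys.W * D‖ ≤ C * ‖Sys.W‖ * ‖D‖ :=
        (norm_mul_le _ _).trans (mul_le_mul_of_nonneg_right ((norm_mul_le _ _).trans
          (mul_le_mul_of_nonneg_right (hC t ht) (norm_nonneg _))) (norm_nonneg _))
      have h3 := norm_mul_le D (Sys.F * Θ)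
      have h4 := norm_mul_le Sys.Fᵀ D
      rw [e]
      refine (norm_sub_le _ _).trans ?_
      have h5 := norm_sub_le (P t * Sys.W * D) (D * (Sys.F * Θ))
      linarith)
  rw [← hfix ξ hξ, mulVec_mulVec, key a ⟨le_rfl, ha⟩, zero_mulVec]

/-- `Y` is the fundamental matrix on `(-∞, T]`, normalised by `Y(T) = I`, of the closed loop
`x' = (F - W P(t)) x`. -/
structure IsFundamental (Sys : LQSystem n m) (T : ℝ) (P Y : ℝ → Matrix (Fin n) (Fin n) ℝ) :
    Prop where
  terminal : Y T = 1
  inv_mul : ∀ t ≤ T, (Y t)⁻¹ * Y t = 1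
  hasDeriv : ∀ t ≤ T, ∀ i j,
    HasDerivAt (fun s => Y s i j) (((Sys.F - Sys.W * P t) * Y t) i j) t
  hasDeriv_inv : ∀ t ≤ T, ∀ i j,
    HasDerivAt (fun s => (Y s)⁻¹ i j) (-((Y t)⁻¹ * (Sys.F - Sys.W * P t)) i j) t

/-- Take `P = Z Y⁻¹` from the Hamiltonian system. Since `F Y - W Z = (F - W P) Y`, the same `Y` is
the closed-loop fundamental matrix. -/
theorem exists_isGRDESolution (hPi : Sys.popov.PosSemidef) (hK : K.PosSemidef) (T : ℝ) :
    ∃ P Y, Sys.IsGRDESolution T K P ∧ Sys.IsFundamental T P Y := by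
  obtain ⟨Y, Z, hYT, hZT, hY, hZ⟩ := exists_hamiltonian_solution Sys.F Sys.W Sys.Q₀ K T
  have hu : ∀ t ≤ T, IsUnit (Y t) := fun t ht =>
    isUnit_of_hamiltonian_solution (posSemidef_W hPi) (posSemidef_Q₀ hPi) hK hYT hZT hY hZ ht
  have hinv : ∀ t ≤ T, Y t * (Y t)⁻¹ = 1 := fun t ht =>
    Matrix.mul_nonsing_inv _ ((Matrix.isUnit_iff_isUnit_det _).1 (hu t ht))
  have hinv' : ∀ t ≤ T, (Y t)⁻¹ * Y t = 1 := fun t ht =>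
    Matrix.nonsing_inv_mul _ ((Matrix.isUnit_iff_isUnit_det _).1 (hu t ht))
  have hY' : ∀ t ≤ T,
      Sys.F * Y t - Sys.W * Z t = (Sys.F - Sys.W * (Z t * (Y t)⁻¹)) * Y t := by
    intro t ht
    rw [Matrix.sub_mul, Matrix.mul_assoc Sys.W, Matrix.mul_assoc (Z t), hinv' t ht, Matrix.mul_one]
  have entry : ∀ {f : ℝ → Matrix (Fin n) (Fin n) ℝ} {f' : Matrix (Fin n) (Fin n) ℝ} {t : ℝ},
      HasDerivAt f f' t → ∀ i j, HasDerivAt (fun s => f s i j) (f' i j) t := by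
    intro f f' t h i j
    exact ((hasDerivWithinAt_matrix_iff (s := Set.univ)).1 h.hasDerivWithinAt i j).hasDerivAt
      Filter.univ_mem
  refine ⟨fun t => Z t * (Y t)⁻¹, Y, ⟨fun t ht i j => ?_, ?_⟩, ⟨hYT, hinv', fun t ht i j => ?_,
    fun t ht i j => ?_⟩⟩
  · have h := (hZ t).fun_mul ((hY t).matrix_inv (hu t ht))
    refine (entry (h.congr_deriv (g' := -Sys.riccati (Z t * (Y t)⁻¹)) ?_) i j).hasDerivWithinAt
    rw [riccati_eq hPi]
    simp only [Matrix.mul_sub, Matrix.sub_mul, Matrix.mul_neg, Matrix.neg_mul, Matrix.mul_assoc,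
      hinv t ht, Matrix.mul_one]
    abel
  · simp [hYT, hZT]
  · exact entry ((hY t).congr_deriv (hY' t ht)) i j
  · refine entry (((hY t).matrix_inv (hu t ht)).congr_deriv
      (g' := -((Y t)⁻¹ * (Sys.F - Sys.W * (Z t * (Y t)⁻¹)))) ?_) i j
    rw [hY' t ht, Matrix.mul_assoc, Matrix.mul_assoc, hinv t ht, Matrix.mul_one]

end LQSystem

/-! ### Calculus of indefinite integrals -/

theorem IntervalIntegrable.mono_Icc {f : ℝ → ℝ} {t T : ℝ} (hf : IntervalIntegrable f volume 0 T)
    (ht : t ∈ Set.Icc 0 T) : IntervalIntegrable f volume 0 t :=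
  hf.mono_set (by
    rw [Set.uIcc_of_le ht.1, Set.uIcc_of_le (ht.1.trans ht.2)]
    exact Set.Icc_subset_Icc_right ht.2)

/-- `f` is, on `[0, T]`, an indefinite integral of the integrable function `f'`. -/
structure IsIntegralOf (T : ℝ) (f f' : ℝ → ℝ) : Prop where
  intervalIntegrable : IntervalIntegrable f' volume 0 T
  eq_add_integral : ∀ t ∈ Set.Icc 0 T, f t = f 0 + ∫ s in (0 : ℝ)..t, f' s

namespace IsIntegralOf

variable {T : ℝ} {f f' g g' : ℝ → ℝ}

theorem mono_integrable (hf : IsIntegralOf T f f') {t : ℝ} (ht : t ∈ Set.Icc 0 T) :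
    IntervalIntegrable f' volume 0 t :=
  hf.intervalIntegrable.mono_Icc ht

theorem continuousOn (hf : IsIntegralOf T f f') (hT : 0 ≤ T) :
    ContinuousOn f (Set.Icc 0 T) := by
  have h := intervalIntegral.continuousOn_primitive_interval (a := 0) (b := T) (f := f')
    (μ := volume) (by
      rw [Set.uIcc_of_le hT]
      exact (intervalIntegrable_iff_integrableOn_Icc_of_le hT).1 hf.intervalIntegrable)
  rw [Set.uIcc_of_le hT] at h
  exact (continuousOn_const.add h).congr hf.eq_add_integral

theorem congr_deriv (hf : IsIntegralOf T f f') (hT : 0 ≤ T)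
    (h : Set.EqOn f' g' (Set.Icc 0 T)) : IsIntegralOf T f g' := by
  refine ⟨hf.intervalIntegrable.congr fun s hs => h ?_, fun t ht => ?_⟩
  · rw [Set.uIoc_of_le hT] at hs
    exact Set.Ioc_subset_Icc_self hs
  · rw [hf.eq_add_integral t ht]
    congr 1
    refine intervalIntegral.integral_congr fun s hs => h ?_
    rw [Set.uIcc_of_le ht.1] at hs
    exact ⟨hs.1, hs.2.trans ht.2⟩

theorem sum {ι : Type*} (s : Finset ι) {f f' : ι → ℝ → ℝ}
    (h : ∀ i ∈ s, IsIntegralOf T (f i) (f' i)) :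
    IsIntegralOf T (fun t => ∑ i ∈ s, f i t) (fun t => ∑ i ∈ s, f' i t) := by
  refine ⟨?_, fun t ht => ?_⟩
  · simpa only [Finset.sum_fn] using
      IntervalIntegrable.sum s fun i hi => (h i hi).intervalIntegrable
  · rw [intervalIntegral.integral_finsetSum fun i hi => (h i hi).mono_integrable ht,
      ← Finset.sum_add_distrib]
    exact Finset.sum_congr rfl fun i hi => (h i hi).eq_add_integral t ht

/-- Integration by parts, in the form of a product rule. -/
theorem mul (hf : IsIntegralOf T f f') (hg : IsIntegralOf T g g') (hT : 0 ≤ T) :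
    IsIntegralOf T (fun t => f t * g t) (fun t => f' t * g t + f t * g' t) := by
  refine ⟨?_, fun t ht => ?_⟩
  · refine IntervalIntegrable.add ?_ ?_
    · exact hf.intervalIntegrable.mul_continuousOn
        (by rw [Set.uIcc_of_le hT]; exact hg.continuousOn hT)
    · exact hg.intervalIntegrable.continuousOn_mul
        (by rw [Set.uIcc_of_le hT]; exact hf.continuousOn hT)
  -- Nothing is known of `f` and `g` outside `[0, T]`, so integration by parts is applied to the
  -- primitives `f 0 + ∫ f'` and `g 0 + ∫ g'`, which are absolutely continuous and agree with them
  -- there.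
  · have hconst : ∀ c : ℝ, AbsolutelyContinuousOnInterval (fun _ : ℝ => c) 0 t := fun c =>
      (contDiff_const.contDiffOn).absolutelyContinuousOnInterval
    have hfi := hf.mono_integrable ht
    have hgi := hg.mono_integrable ht
    have hF := (hconst (f 0)).add
      (hfi.absolutelyContinuousOnInterval_intervalIntegral (c := 0) Set.left_mem_uIcc)
    have hG := (hconst (g 0)).add
      (hgi.absolutelyContinuousOnInterval_intervalIntegral (c := 0) Set.left_mem_uIcc)
    have h := hF.integral_deriv_mul_eq_sub hG
    have e : ∫ s in (0 : ℝ)..t, f' s * g s + f s * g' s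
        = f t * g t - f 0 * g 0 := by
      rw [hf.eq_add_integral t ht, hg.eq_add_integral t ht]
      simp only [Pi.add_apply, intervalIntegral.integral_same, add_zero] at h
      rw [← h]
      refine intervalIntegral.integral_congr_ae ?_
      filter_upwards [hfi.ae_hasDerivAt_integral, hgi.ae_hasDerivAt_integral] with s hs hs' hst
      have hst' := Set.uIoc_subset_uIcc hst
      have h1 := (hs hst' 0 Set.left_mem_uIcc).const_add (f 0)
      have h2 := (hs' hst' 0 Set.left_mem_uIcc).const_add (g 0)
      have hmem : s ∈ Set.Icc 0 T := by
        rw [Set.uIcc_of_le ht.1] at hst'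
        exact ⟨hst'.1, hst'.2.trans ht.2⟩
      rw [show deriv ((fun _ => f 0) + fun x => ∫ v in (0 : ℝ)..x, f' v) s = f' s from h1.deriv,
        show deriv ((fun _ => g 0) + fun x => ∫ v in (0 : ℝ)..x, g' v) s = g' s from h2.deriv,
        hf.eq_add_integral s hmem, hg.eq_add_integral s hmem]
    rw [e]
    ring

theorem of_hasDerivWithinAt (hT : 0 ≤ T)
    (hf : ∀ t ∈ Set.Icc 0 T, HasDerivWithinAt f (f' t) (Set.Iic T) t)
    (hf' : ContinuousOn f' (Set.Icc 0 T)) : IsIntegralOf T f f' := by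
  have hint : IntervalIntegrable f' volume 0 T :=
    ContinuousOn.intervalIntegrable (by rwa [Set.uIcc_of_le hT])
  refine ⟨hint, fun t ht => ?_⟩
  have hsub : Set.Icc 0 t ⊆ Set.Icc 0 T := Set.Icc_subset_Icc_right ht.2
  rw [intervalIntegral.integral_eq_sub_of_hasDeriv_right (f := f)]
  · ring
  · rw [Set.uIcc_of_le ht.1]
    exact fun s hs => ((hf s (hsub hs)).continuousWithinAt).mono fun r hr => (hsub hr).2
  · rw [min_eq_left ht.1, max_eq_right ht.1]
    intro s hs
    have hs' : s < T := hs.2.trans_le ht.2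
    exact ((hf s ⟨hs.1.le, hs'.le⟩).hasDerivAt (Iic_mem_nhds hs')).hasDerivWithinAt
  · exact hint.mono_Icc ht

theorem dotProduct {ι : Type*} [Fintype ι] {f f' g g' : ℝ → ι → ℝ} (hT : 0 ≤ T)
    (hf : ∀ i, IsIntegralOf T (fun t => f t i) (fun t => f' t i))
    (hg : ∀ i, IsIntegralOf T (fun t => g t i) (fun t => g' t i)) :
    IsIntegralOf T (fun t => f t ⬝ᵥ g t) (fun t => f' t ⬝ᵥ g t + f t ⬝ᵥ g' t) := by
  simp only [_root_.dotProduct, ← Finset.sum_add_distrib]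
  exact sum _ fun i _ => (hf i).mul (hg i) hT

theorem mulVec {ι : Type*} [Fintype ι] {M M' : ℝ → Matrix ι ι ℝ} {g g' : ℝ → ι → ℝ} (hT : 0 ≤ T)
    (hM : ∀ i j, IsIntegralOf T (fun t => M t i j) (fun t => M' t i j))
    (hg : ∀ i, IsIntegralOf T (fun t => g t i) (fun t => g' t i)) (i : ι) :
    IsIntegralOf T (fun t => (M t *ᵥ g t) i) (fun t => (M' t *ᵥ g t + M t *ᵥ g' t) i) :=
  dotProduct hT (fun j => hM i j) hg

end IsIntegralOf

theorem ContinuousOn.matrix_mulVec' {α ι κ : Type*} [TopologicalSpace α] [Fintype κ]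
    {s : Set α} {M : α → Matrix ι κ ℝ} {x : α → κ → ℝ}
    (hM : ∀ i j, ContinuousOn (fun t => M t i j) s) (hx : ContinuousOn x s) :
    ContinuousOn (fun t => M t *ᵥ x t) s := by
  refine continuousOn_pi.2 fun i => ?_
  simp only [mulVec, dotProduct]
  exact continuousOn_finsetSum _ fun j _ => (hM i j).mul (continuousOn_pi.1 hx j)

theorem ContinuousOn.matrix_mul_apply {α ι κ μ : Type*} [TopologicalSpace α] [Fintype κ]
    {s : Set α} {M : α → Matrix ι κ ℝ} {N : α → Matrix κ μ ℝ}
    (hM : ∀ i j, ContinuousOn (fun t => M t i j) s)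
    (hN : ∀ i j, ContinuousOn (fun t => N t i j) s) (i : ι) (j : μ) :
    ContinuousOn (fun t => (M t * N t) i j) s := by
  simp only [Matrix.mul_apply]
  exact continuousOn_finsetSum _ fun k _ => (hM i k).mul (hN k j)

/-! ### Admissible controls and the cost formula -/

namespace LQSystem

variable {n m : ℕ} {Sys : LQSystem n m} {T : ℝ}

theorem IsL2.of_continuousOn {u : ℝ → Fin m → ℝ} (hu : ContinuousOn u (Set.Icc 0 T)) :
    IsL2 T u := by
  obtain ⟨C, hC⟩ := isCompact_Icc.exists_bound_of_continuousOn hu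
  exact MemLp.of_bound (hu.aestronglyMeasurable measurableSet_Icc) C
    ((ae_restrict_mem measurableSet_Icc).mono hC)

theorem IsL2.mulVec {k : ℕ} {u : ℝ → Fin m → ℝ} (hu : IsL2 T u) (M : Matrix (Fin k) (Fin m) ℝ) :
    IsL2 T (fun t => M *ᵥ u t) :=
  MemLp.continuousLinearMap_comp hu (LinearMap.toContinuousLinearMap M.mulVecLin)

theorem IsL2.intervalIntegrable {u : ℝ → Fin m → ℝ} (hu : IsL2 T u) (hT : 0 ≤ T) (i : Fin m) :
    IntervalIntegrable (fun t => u t i) volume 0 T :=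
  (intervalIntegrable_iff_integrableOn_Icc_of_le hT).2
    ((MemLp.eval hu i).integrable one_le_two)

/-- Quadratic expressions in square-integrable signals are integrable. -/
theorem IsL2.intervalIntegrable_bilin {k : ℕ} {u : ℝ → Fin m → ℝ} {x : ℝ → Fin k → ℝ}
    (hu : IsL2 T u) (hx : IsL2 T x) (hT : 0 ≤ T) (M : Matrix (Fin k) (Fin m) ℝ) :
    IntervalIntegrable (fun t => x t ⬝ᵥ (M *ᵥ u t)) volume 0 T := by
  simp only [dotProduct]
  have h := IntervalIntegrable.sum (μ := volume) (a := 0) (b := T) Finset.univ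
    (f := fun (i : Fin k) (t : ℝ) => x t i * (M *ᵥ u t) i) fun i _ =>
      (intervalIntegrable_iff_integrableOn_Icc_of_le hT).2
        (MemLp.integrable_mul (MemLp.eval hx i) (MemLp.eval (hu.mulVec M) i))
  simpa only [Finset.sum_fn] using h

theorem IsAdmissible.isIntegralOf {x₀ : Fin n → ℝ} {u : ℝ → Fin m → ℝ} {x : ℝ → Fin n → ℝ}
    (h : Sys.IsAdmissible T x₀ u x) (hT : 0 ≤ T) (i : Fin n) :
    IsIntegralOf T (fun t => x t i) (fun t => (Sys.A *ᵥ x t + Sys.B *ᵥ u t) i) := by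
  have hL : IsL2 T (fun t => Sys.A *ᵥ x t + Sys.B *ᵥ u t) :=
    MemLp.add ((IsL2.of_continuousOn h.continuousOn).mulVec Sys.A) (h.memL2.mulVec Sys.B)
  have h0 : x 0 = x₀ := by simpa using h.eq_integral 0 ⟨le_rfl, hT⟩
  refine ⟨hL.intervalIntegrable hT i, fun t ht => ?_⟩
  have h1 := congrFun (h.eq_integral t ht) i
  rw [h1, Pi.add_apply, h0, intervalIntegral.integral_of_le ht.1,
    intervalIntegral.integral_of_le ht.1, eval_integral]
  intro j
  exact (intervalIntegrable_iff_integrableOn_Ioc_of_le ht.1).1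
    ((hL.intervalIntegrable hT j).mono_Icc ht)

theorem IsAdmissible.of_isIntegralOf {x₀ : Fin n → ℝ} {u : ℝ → Fin m → ℝ} {x : ℝ → Fin n → ℝ}
    (hT : 0 ≤ T) (hu : IsL2 T u) (h0 : x 0 = x₀)
    (hx : ∀ i, IsIntegralOf T (fun t => x t i) (fun t => (Sys.A *ᵥ x t + Sys.B *ᵥ u t) i)) :
    Sys.IsAdmissible T x₀ u x := by
  refine ⟨hu, continuousOn_pi.2 fun i => (hx i).continuousOn hT, fun t ht => ?_⟩
  ext i
  rw [(hx i).eq_add_integral t ht, Pi.add_apply, h0, intervalIntegral.integral_of_le ht.1,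
    intervalIntegral.integral_of_le ht.1, eval_integral]
  intro j
  exact (intervalIntegrable_iff_integrableOn_Ioc_of_le ht.1).1 ((hx j).mono_integrable ht)

variable {K : Matrix (Fin n) (Fin n) ℝ} {P : ℝ → Matrix (Fin n) (Fin n) ℝ}

theorem IsGRDESolution.continuousOn (h : Sys.IsGRDESolution T K P) (i j : Fin n) :
    ContinuousOn (fun t => P t i j) (Set.Icc 0 T) := fun t ht =>
  ((h.hasDeriv t ht.2 i j).continuousWithinAt).mono Set.Icc_subset_Iic_self

theorem IsGRDESolution.continuousOn_gain (h : Sys.IsGRDESolution T K P) (i : Fin m) (j : Fin n) :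
    ContinuousOn (fun t => Sys.gain (P t) i j) (Set.Icc 0 T) := by
  refine ContinuousOn.matrix_mul_apply (M := fun _ => pinv Sys.R) (fun _ _ => continuousOn_const)
    (fun i j => ?_) i j
  exact continuousOn_const.add
    (ContinuousOn.matrix_mul_apply (M := fun _ => Sys.Bᵀ) (fun _ _ => continuousOn_const)
      h.continuousOn i j)

theorem IsGRDESolution.isIntegralOf (hPi : Sys.popov.PosSemidef) (h : Sys.IsGRDESolution T K P)
    (hT : 0 ≤ T) (i j : Fin n) :
    IsIntegralOf T (fun t => P t i j) (fun t => (-Sys.riccati (P t)) i j) := by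
  refine IsIntegralOf.of_hasDerivWithinAt hT (fun t ht => h.hasDeriv t ht.2 i j) ?_
  simp only [riccati_eq hPi]
  have hc := h.continuousOn
  have hk : ∀ M : Matrix (Fin n) (Fin n) ℝ, ∀ i j,
      ContinuousOn (fun _ : ℝ => M i j) (Set.Icc 0 T) := fun _ _ _ => continuousOn_const
  exact ((((ContinuousOn.matrix_mul_apply hc (hk Sys.F) i j).add
    (ContinuousOn.matrix_mul_apply (hk Sys.Fᵀ) hc i j)).sub
    (ContinuousOn.matrix_mul_apply (ContinuousOn.matrix_mul_apply hc (hk Sys.W)) hc i j)).add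
    (hk Sys.Q₀ i j)).neg

/-- The integrand left after completing the square in the cost. -/
noncomputable def deviation (Sys : LQSystem n m) (P : ℝ → Matrix (Fin n) (Fin n) ℝ)
    (u : ℝ → Fin m → ℝ) (x : ℝ → Fin n → ℝ) (t : ℝ) : ℝ :=
  (u t + Sys.gain (P t) *ᵥ x t) ⬝ᵥ (Sys.R *ᵥ (u t + Sys.gain (P t) *ᵥ x t))

section Cost

variable {x₀ : Fin n → ℝ} {u : ℝ → Fin m → ℝ} {x : ℝ → Fin n → ℝ}

theorem IsGRDESolution.isL2_gain (h : Sys.IsGRDESolution T K P)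
    (hx : ContinuousOn x (Set.Icc 0 T)) : IsL2 T (fun t => Sys.gain (P t) *ᵥ x t) :=
  IsL2.of_continuousOn (ContinuousOn.matrix_mulVec' h.continuousOn_gain hx)

theorem IsGRDESolution.intervalIntegrable_deviation (hT : 0 ≤ T) (h : Sys.IsGRDESolution T K P)
    (hux : Sys.IsAdmissible T x₀ u x) :
    IntervalIntegrable (Sys.deviation P u x) volume 0 T := by
  have hL : IsL2 T (fun t => u t + Sys.gain (P t) *ᵥ x t) :=
    MemLp.add hux.memL2 (h.isL2_gain hux.continuousOn)
  exact hL.intervalIntegrable_bilin hL hT _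

/-- Writing the terminal cost as `x₀ᵀ P(0) x₀` plus the integral of the derivative of `xᵀ P x` puts
everything under one integral, where the square is completed; `hX` and `hKR` supply the required `P
B G = 0`. -/
theorem IsGRDESolution.cost_eq (hPi : Sys.popov.PosSemidef) (hX : ∃ X, Sys.IsCGCARESolution X)
    (hT : 0 ≤ T) (hK : K.PosSemidef) (hKR : ∀ ξ ∈ Sys.reachable, K *ᵥ ξ = 0)
    (h : Sys.IsGRDESolution T K P) (hux : Sys.IsAdmissible T x₀ u x) :
    Sys.cost T K u x
      = x₀ ⬝ᵥ (P 0 *ᵥ x₀) + ∫ t in (0 : ℝ)..T, Sys.deviation P u x t := by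
  have hxi := hux.isIntegralOf hT
  have h0 : x 0 = x₀ := by simpa using hux.eq_integral 0 ⟨le_rfl, hT⟩
  have hV := IsIntegralOf.dotProduct hT hxi
    (IsIntegralOf.mulVec hT (h.isIntegralOf hPi hT) hxi)
  have hxL := IsL2.of_continuousOn hux.continuousOn
  have hq : IntervalIntegrable (fun t => Sum.elim (x t) (u t) ⬝ᵥ
      (Sys.popov *ᵥ Sum.elim (x t) (u t))) volume 0 T := by
    simp only [popov_quadratic]
    exact ((hxL.intervalIntegrable_bilin hxL hT _).add
      ((hux.memL2.intervalIntegrable_bilin hxL hT _).const_mul 2)).add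
      (hux.memL2.intervalIntegrable_bilin hux.memL2 hT _)
  have hVT := hV.eq_add_integral T ⟨hT, le_rfl⟩
  simp only [h0, h.terminal] at hVT
  rw [cost, hVT, add_left_comm, ← intervalIntegral.integral_add hq hV.intervalIntegrable]
  congr 1
  refine intervalIntegral.integral_congr fun t ht => ?_
  rw [Set.uIcc_of_le hT] at ht
  have hG : P t * (Sys.B * Sys.G) = 0 := Matrix.ext_mulVec fun w => by
    rw [← mulVec_mulVec, zero_mulVec]
    exact h.mulVec_eq_zero hPi hX hKR ht.2 (Sys.B_mul_G_mulVec_mem_reachable w)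
  have e := popov_quadratic_add_deriv hPi (h.isSymm hPi hK.isSymm_real ht.2) hG (x t) (u t)
  simp only [dotProduct_add, deviation] at e ⊢
  rw [← e]
  ring

theorem deviation_eq_zero_iff (hPi : Sys.popov.PosSemidef) (t : ℝ) :
    Sys.deviation P u x t = 0 ↔ Sys.R *ᵥ (u t + Sys.gain (P t) *ᵥ x t) = 0 :=
  ⟨fun h => (posSemidef_R hPi).mulVec_eq_zero_real h, fun h => by rw [deviation, h, dotProduct_zero]⟩

theorem integral_deviation_nonneg (hPi : Sys.popov.PosSemidef) (hT : 0 ≤ T) :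
    0 ≤ ∫ t in (0 : ℝ)..T, Sys.deviation P u x t :=
  intervalIntegral.integral_nonneg hT fun _ _ => (posSemidef_R hPi).nonneg_real _

/-- The squared term vanishes exactly along the feedback controls. -/
theorem IsGRDESolution.integral_deviation_eq_zero_iff (hPi : Sys.popov.PosSemidef) (hT : 0 ≤ T)
    (h : Sys.IsGRDESolution T K P) (hux : Sys.IsAdmissible T x₀ u x) :
    ∫ t in (0 : ℝ)..T, Sys.deviation P u x t = 0 ↔
      ∃ v, IsL2 T v ∧ Sys.IsFeedback T P u x v := by
  have hiff : ∫ t in (0 : ℝ)..T, Sys.deviation P u x t = 0 ↔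
      ∀ᵐ t ∂(volume.restrict (Set.Icc 0 T)), Sys.R *ᵥ (u t + Sys.gain (P t) *ᵥ x t) = 0 := by
    rw [intervalIntegral.integral_eq_zero_iff_of_nonneg_ae (f := Sys.deviation P u x)
      (Filter.Eventually.of_forall fun t => (posSemidef_R hPi).nonneg_real _)
      (h.intervalIntegrable_deviation hT hux), Set.Ioc_eq_empty hT.not_gt, Set.union_empty,
      ← restrict_Ioc_eq_restrict_Icc]
    exact Filter.eventually_congr
      (Filter.Eventually.of_forall fun t => deviation_eq_zero_iff hPi t)
  rw [hiff]
  constructor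
  · intro hR
    -- The deviation itself serves as `v`: it lies in `ker R`, where `G` is the identity.
    refine ⟨fun t => u t + Sys.gain (P t) *ᵥ x t,
      MemLp.add hux.memL2 (h.isL2_gain hux.continuousOn), ?_⟩
    filter_upwards [hR] with t ht
    rw [G, sub_mulVec, one_mulVec, ← mulVec_mulVec, ht, mulVec_zero]
    simp
  · rintro ⟨v, -, hv⟩
    filter_upwards [hv] with t ht
    rw [ht, neg_add_eq_sub, sub_add_cancel, mulVec_mulVec, R_mul_G, zero_mulVec]

end Cost

end LQSystem

/-! ### Closed-loop responses, steering and verification -/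

theorem eqOn_zero_of_integral_eq_zero {T : ℝ} (hT : 0 < T) {g : ℝ → ℝ}
    (hg : ContinuousOn g (Set.Icc 0 T)) (hnn : ∀ t, 0 ≤ g t) (h : ∫ t in (0 : ℝ)..T, g t = 0) :
    ∀ t ∈ Set.Icc 0 T, g t = 0 := by
  rw [intervalIntegral.integral_eq_zero_iff_of_nonneg_ae (Filter.Eventually.of_forall hnn)
    (ContinuousOn.intervalIntegrable (by rwa [Set.uIcc_of_le hT.le])), Set.Ioc_eq_empty hT.not_gt,
    Set.union_empty, restrict_Ioc_eq_restrict_Icc] at h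
  exact Measure.eqOn_Icc_of_ae_eq volume hT.ne h hg continuousOn_const

namespace LQSystem

variable {n m : ℕ} {Sys : LQSystem n m} {T : ℝ} {K : Matrix (Fin n) (Fin n) ℝ}
  {P Y : ℝ → Matrix (Fin n) (Fin n) ℝ}

theorem IsFundamental.mul_inv (hY : Sys.IsFundamental T P Y) {t : ℝ} (ht : t ≤ T) :
    Y t * (Y t)⁻¹ = 1 :=
  mul_eq_one_comm.1 (hY.inv_mul t ht)

theorem IsFundamental.continuousOn (hY : Sys.IsFundamental T P Y) (i j : Fin n) :
    ContinuousOn (fun t => Y t i j) (Set.Icc 0 T) := fun t ht =>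
  (hY.hasDeriv t ht.2 i j).continuousAt.continuousWithinAt

theorem IsFundamental.continuousOn_inv (hY : Sys.IsFundamental T P Y) (i j : Fin n) :
    ContinuousOn (fun t => (Y t)⁻¹ i j) (Set.Icc 0 T) := fun t ht =>
  (hY.hasDeriv_inv t ht.2 i j).continuousAt.continuousWithinAt

theorem IsFundamental.isIntegralOf (hT : 0 ≤ T) (h : Sys.IsGRDESolution T K P)
    (hY : Sys.IsFundamental T P Y) (i j : Fin n) :
    IsIntegralOf T (fun t => Y t i j) (fun t => ((Sys.F - Sys.W * P t) * Y t) i j) := by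
  refine IsIntegralOf.of_hasDerivWithinAt hT
    (fun t ht => (hY.hasDeriv t ht.2 i j).hasDerivWithinAt) ?_
  refine ContinuousOn.matrix_mul_apply (fun i j => ?_) hY.continuousOn i j
  exact continuousOn_const.sub
    (ContinuousOn.matrix_mul_apply (M := fun _ => Sys.W) (fun _ _ => continuousOn_const)
      h.continuousOn i j)

/-- Variation of constants for the closed loop, with square-integrable forcing. -/
theorem IsFundamental.exists_closedLoop (hT : 0 ≤ T) (h : Sys.IsGRDESolution T K P)
    (hY : Sys.IsFundamental T P Y) (x₀ : Fin n → ℝ) {v : ℝ → Fin m → ℝ} (hv : IsL2 T v) :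
    ∃ u x, Sys.IsAdmissible T x₀ u x ∧ Sys.IsFeedback T P u x v ∧
      ∀ i, x T i = ((Y 0)⁻¹ *ᵥ x₀) i
        + ∫ s in (0 : ℝ)..T, ((Y s)⁻¹ *ᵥ ((Sys.B * Sys.G) *ᵥ v s)) i := by
  set q : ℝ → Fin n → ℝ := fun s => (Y s)⁻¹ *ᵥ ((Sys.B * Sys.G) *ᵥ v s) with hq
  -- This is `Y⁻¹ x`, whose derivative contains only the forcing; it equals `x` at `T` because `Y T
  -- = 1`.
  set p : ℝ → Fin n → ℝ := fun t i => ((Y 0)⁻¹ *ᵥ x₀) i + ∫ s in (0 : ℝ)..t, q s i with hp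
  have hqi : ∀ i, IntervalIntegrable (fun s => q s i) volume 0 T := by
    intro i
    have hs := IntervalIntegrable.sum (μ := volume) (a := 0) (b := T) Finset.univ
      (f := fun (j : Fin n) (s : ℝ) => (Y s)⁻¹ i j * ((Sys.B * Sys.G) *ᵥ v s) j) fun j _ =>
        ((hv.mulVec (Sys.B * Sys.G)).intervalIntegrable hT j).continuousOn_mul
          (by rw [Set.uIcc_of_le hT]; exact hY.continuousOn_inv i j)
    simp only [Finset.sum_fn] at hs
    exact hs
  have hpi : ∀ i, IsIntegralOf T (fun t => p t i) (fun t => q t i) := fun i =>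
    ⟨hqi i, fun t _ => by simp [hp]⟩
  set x : ℝ → Fin n → ℝ := fun t => Y t *ᵥ p t with hx
  set u : ℝ → Fin m → ℝ := fun t => -(Sys.gain (P t) *ᵥ x t) + Sys.G *ᵥ v t with hu
  have hxi : ∀ i, IsIntegralOf T (fun t => x t i)
      (fun t => (Sys.A *ᵥ x t + Sys.B *ᵥ u t) i) := by
    intro i
    refine (IsIntegralOf.mulVec hT (hY.isIntegralOf hT h) hpi i).congr_deriv hT fun t ht => ?_
    have e : ((Sys.F - Sys.W * P t) * Y t) *ᵥ p t + Y t *ᵥ q t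
        = Sys.A *ᵥ x t + Sys.B *ᵥ u t := by
      rw [hq, hu]
      simp only
      rw [mulVec_mulVec (v := (Sys.B * Sys.G) *ᵥ v t), hY.mul_inv ht.2, one_mulVec, mulVec_add,
        mulVec_neg, mulVec_mulVec (v := x t), mulVec_mulVec (v := v t), ← add_assoc,
        ← sub_eq_add_neg, ← sub_mulVec, A_sub_B_mul_gain, ← mulVec_mulVec]
    exact congrFun e i
  have hxc : ContinuousOn x (Set.Icc 0 T) := continuousOn_pi.2 fun i => (hxi i).continuousOn hT
  refine ⟨u, x, IsAdmissible.of_isIntegralOf hT ?_ ?_ hxi, Filter.Eventually.of_forall fun t => rfl,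
    fun i => ?_⟩
  · exact MemLp.add (h.isL2_gain hxc).neg (hv.mulVec Sys.G)
  · have hp0 : p 0 = (Y 0)⁻¹ *ᵥ x₀ := by ext i; simp [hp]
    simp only [hx]
    rw [hp0, mulVec_mulVec, hY.mul_inv hT, one_mulVec]
  · simp only [hx, hY.terminal, one_mulVec]
    rfl

/-- A costate that is orthogonal to all forced responses is orthogonal to the reachable subspace. -/
theorem IsFundamental.dotProduct_eq_zero_of_forall (hPi : Sys.popov.PosSemidef)
    (hX : ∃ X, Sys.IsCGCARESolution X) (hT : 0 < T) (hKR : ∀ ξ ∈ Sys.reachable, K *ᵥ ξ = 0)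
    (h : Sys.IsGRDESolution T K P) (hY : Sys.IsFundamental T P Y) {η : Fin n → ℝ}
    (hη : ∀ t ∈ Set.Icc 0 T, ∀ w, η ⬝ᵥ ((Y t)⁻¹ *ᵥ ((Sys.B * Sys.G) *ᵥ w)) = 0)
    {ξ : Fin n → ℝ} (hξ : ξ ∈ Sys.reachable) : η ⬝ᵥ ξ = 0 := by
  have key : ∀ k : ℕ, ∀ w, ∀ t ∈ Set.Icc 0 T,
      η ⬝ᵥ ((Y t)⁻¹ *ᵥ ((Sys.F ^ k) *ᵥ ((Sys.B * Sys.G) *ᵥ w))) = 0 := by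
    intro k w
    induction k with
    | zero => intro t ht; simpa using hη t ht w
    | succ k ih =>
      intro t ht
      set b := (Sys.F ^ k) *ᵥ ((Sys.B * Sys.G) *ᵥ w) with hb
      have hd : HasDerivAt (fun s => η ⬝ᵥ ((Y s)⁻¹ *ᵥ b))
          (η ⬝ᵥ ((-((Y t)⁻¹ * (Sys.F - Sys.W * P t))) *ᵥ b)) t := by
        simp only [dotProduct, mulVec]
        exact HasDerivAt.fun_sum fun i _ => (HasDerivAt.fun_sum fun j _ =>
          (hY.hasDeriv_inv t ht.2 i j).mul_const (b j)).const_mul (η i)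
      -- The function vanishes on `[0, T]`, so its derivative does too. As `P b = 0`, that
      -- derivative is `-η ⬝ᵥ Y⁻¹ F b`, which gives the next power of `F`.
      have h0 : HasDerivWithinAt (fun s => η ⬝ᵥ ((Y s)⁻¹ *ᵥ b)) 0 (Set.Icc 0 T) t :=
        (hasDerivWithinAt_const t _ (0 : ℝ)).congr ih (ih t ht)
      have h1 := (uniqueDiffOn_Icc hT t ht).eq_deriv _ hd.hasDerivWithinAt h0
      have hPb : P t *ᵥ b = 0 :=
        h.mulVec_eq_zero hPi hX hKR ht.2 (Sys.F_pow_mulVec_mem_reachable k w)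
      rw [neg_mulVec, dotProduct_neg, neg_eq_zero, ← mulVec_mulVec, sub_mulVec, ← mulVec_mulVec,
        hPb, mulVec_zero, sub_zero] at h1
      rw [pow_succ', ← mulVec_mulVec]
      exact h1
  have hle : Sys.reachable ≤ LinearMap.ker (dotProductBilin ℝ ℝ η) :=
    Sys.reachable_le fun k _ w => by
      have h1 := key k w T ⟨hT.le, le_rfl⟩
      rw [hY.terminal, inv_one, one_mulVec] at h1
      simpa using h1
  simpa using hle hξ

/-- Every reachable vector is the response to some continuous forcing (Gramian argument). -/
theorem IsFundamental.exists_steering (hPi : Sys.popov.PosSemidef)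
    (hX : ∃ X, Sys.IsCGCARESolution X) (hT : 0 < T) (hKR : ∀ ξ ∈ Sys.reachable, K *ᵥ ξ = 0)
    (h : Sys.IsGRDESolution T K P) (hY : Sys.IsFundamental T P Y) {ξ : Fin n → ℝ}
    (hξ : ξ ∈ Sys.reachable) :
    ∃ v, IsL2 T v ∧
      ∀ i, ∫ s in (0 : ℝ)..T, ((Y s)⁻¹ *ᵥ ((Sys.B * Sys.G) *ᵥ v s)) i = ξ i := by
  set N : ℝ → Matrix (Fin n) (Fin m) ℝ := fun s => (Y s)⁻¹ * (Sys.B * Sys.G) with hN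
  have hNc : ∀ i j, ContinuousOn (fun s => N s i j) (Set.Icc 0 T) :=
    ContinuousOn.matrix_mul_apply (N := fun _ => Sys.B * Sys.G) hY.continuousOn_inv
      fun _ _ => continuousOn_const
  have hNtc : ∀ i j, ContinuousOn (fun s => (N s)ᵀ i j) (Set.Icc 0 T) := fun i j => hNc j i
  have hNNc := ContinuousOn.matrix_mul_apply hNc hNtc
  have hNNi : ∀ i j, IntervalIntegrable (fun s => (N s * (N s)ᵀ) i j) volume 0 T := fun i j =>
    ContinuousOn.intervalIntegrable (by rw [Set.uIcc_of_le hT.le]; exact hNNc i j)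
  -- The Gramian: the forcing `v = Nᵀ η` produces the response `Γ η`, so it suffices that `ξ` lies
  -- in the range of `Γ`, that is, is orthogonal to its kernel.
  set Γ : Matrix (Fin n) (Fin n) ℝ :=
    Matrix.of fun i j => ∫ s in (0 : ℝ)..T, (N s * (N s)ᵀ) i j with hΓ
  have hΓs : Γ.IsSymm := by
    ext i j
    simp only [hΓ, transpose_apply, of_apply]
    congr 1
    ext s
    rw [← transpose_apply (N s * (N s)ᵀ), transpose_mul, transpose_transpose]
  have hΓv : ∀ η i, (Γ *ᵥ η) i = ∫ s in (0 : ℝ)..T, ((N s * (N s)ᵀ) *ᵥ η) i := by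
    intro η i
    simp only [mulVec, dotProduct, hΓ, of_apply]
    rw [intervalIntegral.integral_finsetSum fun j _ => (hNNi i j).mul_const (η j)]
    simp only [intervalIntegral.integral_mul_const]
  have hquad : ∀ η, η ⬝ᵥ (Γ *ᵥ η)
      = ∫ s in (0 : ℝ)..T, ((N s)ᵀ *ᵥ η) ⬝ᵥ ((N s)ᵀ *ᵥ η) := by
    intro η
    have e : ∀ s, ((N s)ᵀ *ᵥ η) ⬝ᵥ ((N s)ᵀ *ᵥ η) = ∑ i, η i * ((N s * (N s)ᵀ) *ᵥ η) i := by
      intro s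
      rw [dotProduct_transpose_mulVec_comm, mulVec_mulVec]
      rfl
    have hi : ∀ i, IntervalIntegrable (fun s => ((N s * (N s)ᵀ) *ᵥ η) i) volume 0 T := fun i =>
      ContinuousOn.intervalIntegrable (by
        rw [Set.uIcc_of_le hT.le]
        exact continuousOn_pi.1 (ContinuousOn.matrix_mulVec' hNNc continuousOn_const) i)
    simp only [e]
    rw [intervalIntegral.integral_finsetSum fun i _ => (hi i).const_mul (η i)]
    simp only [intervalIntegral.integral_const_mul, dotProduct, hΓv]
  obtain ⟨η, hη⟩ := hΓs.exists_mulVec_eq (ξ := ξ) fun η hη0 => by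
    have hc : ContinuousOn (fun s => (N s)ᵀ *ᵥ η) (Set.Icc 0 T) :=
      ContinuousOn.matrix_mulVec' hNtc continuousOn_const
    have hz := eqOn_zero_of_integral_eq_zero hT
      (g := fun s => ((N s)ᵀ *ᵥ η) ⬝ᵥ ((N s)ᵀ *ᵥ η))
      (by
        simp only [dotProduct]
        exact continuousOn_finsetSum _ fun i _ =>
          (continuousOn_pi.1 hc i).mul (continuousOn_pi.1 hc i))
      (fun s => Finset.sum_nonneg fun i _ => mul_self_nonneg _)
      (by rw [← hquad, hη0, dotProduct_zero])
    refine hY.dotProduct_eq_zero_of_forall hPi hX hT hKR h (fun t ht w => ?_) hξ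
    have h1 : (N t)ᵀ *ᵥ η = 0 := dotProduct_self_eq_zero.1 (hz t ht)
    rw [mulVec_mulVec, ← dotProduct_transpose_mulVec_comm, h1, dotProduct_zero]
  refine ⟨fun s => (N s)ᵀ *ᵥ η,
    IsL2.of_continuousOn (ContinuousOn.matrix_mulVec' hNtc continuousOn_const), fun i => ?_⟩
  rw [← hη, hΓv]
  simp only [mulVec_mulVec, hN, Matrix.mul_assoc]

/-- A final state can be corrected within the reachable subspace so that its weighted image becomes
orthogonal to that subspace. -/
theorem exists_mem_reachable_orthogonal {H : Matrix (Fin n) (Fin n) ℝ} (hH : H.PosSemidef)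
    (y : Fin n → ℝ) :
    ∃ ξ ∈ Sys.reachable, ∀ ζ ∈ Sys.reachable, ζ ⬝ᵥ (H *ᵥ (y + ξ)) = 0 := by
  set U := Sys.reachMatrix with hU
  set M := Uᵀ * H * U with hM
  have hMs := (hH.transpose_mul_mul_real U).isSymm_real
  rw [← hM] at hMs
  have h2 := congrArg Matrix.transpose (Sys.weight_mul_pinv_mul hH)
  rw [← hU, ← hM, transpose_mul, hMs.eq, transpose_mul, hMs.pinv.eq, transpose_mul,
    hH.isSymm_real.eq] at h2
  -- This correction minimises the form of `H` over `y` plus the reachable subspace; orthogonality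
  -- is the normal equation `M M† Uᵀ H y = Uᵀ H y`.
  refine ⟨-(U *ᵥ (pinv M *ᵥ (Uᵀ *ᵥ (H *ᵥ y)))), Submodule.neg_mem _ ⟨_, rfl⟩, ?_⟩
  rintro _ ⟨w, rfl⟩
  have h3 : Uᵀ *ᵥ (H *ᵥ (y + -(U *ᵥ (pinv M *ᵥ (Uᵀ *ᵥ (H *ᵥ y)))))) = 0 := by
    rw [mulVec_add, mulVec_add, mulVec_neg, mulVec_neg, ← sub_eq_add_neg, sub_eq_zero]
    have h4 : Uᵀ * H = Uᵀ * (H * (U * (pinv M * (Uᵀ * H)))) :=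
      h2.symm.trans (by rw [hM]; simp only [Matrix.mul_assoc])
    simp only [mulVec_mulVec]
    exact congrArg (· *ᵥ y) h4
  rw [mulVecLin_apply, dotProduct_comm, ← dotProduct_transpose_mulVec_comm, h3, dotProduct_zero]

/-- Verification theorem: if `K ≤ H` agree exactly on the terminal states satisfying `C`, and some
feedback control reaches `C`, then the optimal controls for `H` are the feedback controls reaching
`C`. -/
theorem IsGRDESolution.verification (hPi : Sys.popov.PosSemidef)
    (hX : ∃ X, Sys.IsCGCARESolution X) (hT : 0 ≤ T) (hK : K.PosSemidef)
    (hKR : ∀ ξ ∈ Sys.reachable, K *ᵥ ξ = 0) (h : Sys.IsGRDESolution T K P)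
    {H : Matrix (Fin n) (Fin n) ℝ} {C : (Fin n → ℝ) → Prop}
    (hle : ∀ y, y ⬝ᵥ (K *ᵥ y) ≤ y ⬝ᵥ (H *ᵥ y))
    (heq : ∀ y, y ⬝ᵥ (K *ᵥ y) = y ⬝ᵥ (H *ᵥ y) ↔ C y) {x₀ : Fin n → ℝ}
    (hex : ∃ u x v, Sys.IsAdmissible T x₀ u x ∧ IsL2 T v ∧ Sys.IsFeedback T P u x v ∧ C (x T)) :
    (∀ u x, Sys.IsAdmissible T x₀ u x →
      (Sys.IsOptimal T H x₀ u x ↔ (∃ v, IsL2 T v ∧ Sys.IsFeedback T P u x v) ∧ C (x T))) ∧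
    IsLeast {J | ∃ u x, Sys.IsAdmissible T x₀ u x ∧ J = Sys.cost T H u x}
      (x₀ ⬝ᵥ (P 0 *ᵥ x₀)) := by
  -- A constant plus two nonnegative defects: the first is zero exactly for feedback controls, the
  -- second exactly for terminal states in `C`.
  have hcost : ∀ u x, Sys.IsAdmissible T x₀ u x → Sys.cost T H u x = x₀ ⬝ᵥ (P 0 *ᵥ x₀)
      + (∫ t in (0 : ℝ)..T, Sys.deviation P u x t)
      + (x T ⬝ᵥ (H *ᵥ x T) - x T ⬝ᵥ (K *ᵥ x T)) := by
    intro u x hux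
    rw [← h.cost_eq hPi hX hT hK hKR hux, cost, cost]
    ring
  have hlow : ∀ u x, Sys.IsAdmissible T x₀ u x → x₀ ⬝ᵥ (P 0 *ᵥ x₀) ≤ Sys.cost T H u x := by
    intro u x hux
    rw [hcost u x hux]
    have := integral_deviation_nonneg (P := P) (u := u) (x := x) hPi hT
    have := hle (x T)
    linarith
  have hval : ∀ u x, Sys.IsAdmissible T x₀ u x → (Sys.cost T H u x = x₀ ⬝ᵥ (P 0 *ᵥ x₀) ↔
      (∃ v, IsL2 T v ∧ Sys.IsFeedback T P u x v) ∧ C (x T)) := by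
    intro u x hux
    rw [hcost u x hux, ← h.integral_deviation_eq_zero_iff hPi hT hux, ← heq]
    have h1 := integral_deviation_nonneg (P := P) (u := u) (x := x) hPi hT
    have h2 := hle (x T)
    constructor
    · intro e
      exact ⟨by linarith, by linarith⟩
    · rintro ⟨e1, e2⟩
      linarith
  obtain ⟨u₀, x₀', v₀, hadm, hv₀, hfb, hC⟩ := hex
  have hopt := (hval _ _ hadm).2 ⟨⟨v₀, hv₀, hfb⟩, hC⟩
  refine ⟨fun u x hux => ?_, ⟨u₀, x₀', hadm, hopt.symm⟩, ?_⟩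
  · rw [← hval u x hux]
    constructor
    · rintro ⟨-, hmin⟩
      exact le_antisymm (hopt ▸ hmin _ _ hadm) (hlow u x hux)
    · intro e
      exact ⟨hux, fun u' x' hux' => e ▸ hlow u' x' hux'⟩
  · rintro _ ⟨u, x, hux, rfl⟩
    exact hlow u x hux

/-- Under the closed loop some forcing makes the final state weight orthogonal to the reachable
subspace. -/
theorem IsFundamental.exists_orthogonal_terminal (hPi : Sys.popov.PosSemidef)
    (hX : ∃ X, Sys.IsCGCARESolution X) (hT : 0 < T) (hKR : ∀ ξ ∈ Sys.reachable, K *ᵥ ξ = 0)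
    (h : Sys.IsGRDESolution T K P) (hY : Sys.IsFundamental T P Y)
    {H : Matrix (Fin n) (Fin n) ℝ} (hH : H.PosSemidef) (x₀ : Fin n → ℝ) :
    ∃ u x v, Sys.IsAdmissible T x₀ u x ∧ IsL2 T v ∧ Sys.IsFeedback T P u x v ∧
      ∀ ζ ∈ Sys.reachable, ζ ⬝ᵥ (H *ᵥ x T) = 0 := by
  obtain ⟨ξ, hξ, hξo⟩ := exists_mem_reachable_orthogonal (Sys := Sys) hH ((Y 0)⁻¹ *ᵥ x₀)
  obtain ⟨v, hv, hvξ⟩ := hY.exists_steering hPi hX hT hKR h hξ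
  obtain ⟨u, x, hadm, hfb, hxT⟩ := hY.exists_closedLoop hT.le h x₀ hv
  refine ⟨u, x, v, hadm, hv, hfb, ?_⟩
  have e : x T = (Y 0)⁻¹ *ᵥ x₀ + ξ := by
    ext i
    rw [hxT, hvξ, Pi.add_apply]
  rwa [e]

end LQSystem

/-! ### The main theorem -/

theorem mainTheorem1 {n m : ℕ} (Sys : LQSystem n m) (hPi : Sys.popov.PosSemidef)
    (hX : ∃ X, Sys.IsCGCARESolution X) (T : ℝ) (hT : 0 < T)
    (H : Matrix (Fin n) (Fin n) ℝ) (hH : H.PosSemidef) :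
    -- impulse-free optimal controls exist for every initial state
    (∀ x₀, ∃ u x, Sys.IsOptimal T H x₀ u x) ∧
    -- the terminal weight vanishes on the reachable subspace
    ((∀ ξ ∈ Sys.reachable, H *ᵥ ξ = 0) →
      ∃ P, Sys.IsGRDESolution T H P ∧
        (∀ P', Sys.IsGRDESolution T H P' → Set.EqOn P' P (Set.Iic T)) ∧
        ∀ x₀,
          (∀ u x, Sys.IsAdmissible T x₀ u x →
            (Sys.IsOptimal T H x₀ u x ↔
              ∃ v, LQSystem.IsL2 T v ∧ Sys.IsFeedback T P u x v)) ∧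
          (∀ v, LQSystem.IsL2 T v →
            ∃ u x, Sys.IsAdmissible T x₀ u x ∧ Sys.IsFeedback T P u x v) ∧
          IsLeast {J | ∃ u x, Sys.IsAdmissible T x₀ u x ∧ J = Sys.cost T H u x}
            (x₀ ⬝ᵥ (P 0 *ᵥ x₀))) ∧
    -- an arbitrary terminal weight
    (∃ P, Sys.IsGRDESolution T (Sys.reducedWeight H) P ∧
        (∀ P', Sys.IsGRDESolution T (Sys.reducedWeight H) P' → Set.EqOn P' P (Set.Iic T)) ∧
        ∀ x₀,
          (∀ u x, Sys.IsAdmissible T x₀ u x →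
            (Sys.IsOptimal T H x₀ u x ↔
              (∃ v, LQSystem.IsL2 T v ∧ Sys.IsFeedback T P u x v) ∧
                ∀ ξ ∈ Sys.reachable, ξ ⬝ᵥ (H *ᵥ x T) = 0)) ∧
          IsLeast {J | ∃ u x, Sys.IsAdmissible T x₀ u x ∧ J = Sys.cost T H u x}
            (x₀ ⬝ᵥ (P 0 *ᵥ x₀))) := by
  have part3 : ∃ P, Sys.IsGRDESolution T (Sys.reducedWeight H) P ∧
        (∀ P', Sys.IsGRDESolution T (Sys.reducedWeight H) P' → Set.EqOn P' P (Set.Iic T)) ∧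
        ∀ x₀,
          (∀ u x, Sys.IsAdmissible T x₀ u x →
            (Sys.IsOptimal T H x₀ u x ↔
              (∃ v, LQSystem.IsL2 T v ∧ Sys.IsFeedback T P u x v) ∧
                ∀ ξ ∈ Sys.reachable, ξ ⬝ᵥ (H *ᵥ x T) = 0)) ∧
          IsLeast {J | ∃ u x, Sys.IsAdmissible T x₀ u x ∧ J = Sys.cost T H u x}
            (x₀ ⬝ᵥ (P 0 *ᵥ x₀)) := by
    have hK := Sys.posSemidef_reducedWeight hH
    have hKR := Sys.mul_reachMatrix_eq_zero_iff.1 (Sys.reducedWeight_mul_reachMatrix hH)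
    obtain ⟨P, Y, hP, hY⟩ := LQSystem.exists_isGRDESolution hPi hK T
    exact ⟨P, hP, fun P' hP' => hP.eqOn hPi hP', fun x₀ =>
      hP.verification hPi hX hT.le hK hKR (Sys.quadratic_reducedWeight_le hH)
        (Sys.quadratic_reducedWeight_eq_iff hH)
        (hY.exists_orthogonal_terminal hPi hX hT hKR hP hH x₀)⟩
  refine ⟨fun x₀ => ?_, fun hHR => ?_, part3⟩
  · obtain ⟨P, -, -, hP⟩ := part3
    obtain ⟨u, x, hux, hJ⟩ := (hP x₀).2.1
    exact ⟨u, x, hux, fun u' x' hux' => hJ ▸ (hP x₀).2.2 ⟨u', x', hux', rfl⟩⟩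
  · obtain ⟨P, Y, hP, hY⟩ := LQSystem.exists_isGRDESolution hPi hH T
    refine ⟨P, hP, fun P' hP' => hP.eqOn hPi hP', fun x₀ => ?_⟩
    have hex : ∀ v, LQSystem.IsL2 T v →
        ∃ u x, Sys.IsAdmissible T x₀ u x ∧ Sys.IsFeedback T P u x v := by
      intro v hv
      obtain ⟨u, x, hux, hfb, -⟩ := hY.exists_closedLoop hT.le hP x₀ hv
      exact ⟨u, x, hux, hfb⟩
    have hzero : LQSystem.IsL2 T (fun _ => (0 : Fin m → ℝ)) :=
      LQSystem.IsL2.of_continuousOn continuousOn_const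
    obtain ⟨u, x, hux, hfb⟩ := hex _ hzero
    -- Here `K = H`, so the weights agree everywhere and the terminal condition is vacuous.
    have hver := hP.verification hPi hX hT.le hH hHR (H := H) (C := fun _ => True)
      (fun _ => le_rfl) (fun _ => by simp) ⟨u, x, _, hux, hzero, hfb, trivial⟩
    exact ⟨fun u x hux => (hver.1 u x hux).trans (and_iff_left trivial), hex, hver.2⟩
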